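/- Let $P\subset\mathbb{R}^d$ be a finite nonempty set of $n$ points that is the union of $m$ (possibly overlapping) groups $P^{(1)},\dots,P^{(m)}$, let $k\in\mathbb{N}$ and $\alpha,\beta\in[0,1]^m$. A fractional assignment of $P$ to a finite set $S\subset\mathbb{R}^d$ is a map $\phi:P\times S\to[0,1]$ with $\sum_{s\in S}\phi(p,s)=1$ for all $p\in P$; it is integral if its values are $0$ or $1$. For $\lambda\ge 0$ it has violation $\lambda$ if $$\beta_i\sum_{p\in P}\phi(p,s)-\lambda\ \le\ \sum_{p\in P^{(i)}}\phi(p,s)\ \le\ \alpha_i\sum_{p\in P}\phi(p,s)+\lambda\qquad\text{for all } s\in S,\ 1\le i\le m,$$ and it is fair if this holds with $\lambda=0$. Its cost is $\mathrm{Cost}(S,\phi)=\sum_{p\in P}\sum_{s\in S}\|p-s\|^2\phi(p,s)$. A fractional (integral) solution of $(\alpha,\beta)$-fair $k$-means is a pair $(S,\phi)$ with $|S|\le k$ and $\phi$ a fair fractional (integral) assignment. Assume that an integral solution exists, and let $OPT$ be the optimal cost of an integral solution. Let $\rho\ge1$, let $A$ be a $\rho$-approximate algorithm for vanilla $k$-means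 on weighted point sets, and let $0<\varepsilon\le 1$. The Relax-and-Merge algorithm works as follows. Relax: construct a finite $\varepsilon$-approximate centroid set $T$ of $P$, that is, for every nonempty $Q\subseteq P$ with centroid $c_Q$ there is $v\in T$ with $\|v-c_Q\|\le\frac{\varepsilon}{3}\sqrt{\frac1{|Q|}\sum_{q\in Q}\|q-c_Q\|^2}$; compute a cheapest fair fractional assignment $\phi_T$ of $P$ to $T$ (a linear program); move every $t\in T$ of positive weight $w(t)=\sum_{p\in P}\phi_T(p,t)$ to $\pi(t)=\frac{1}{w(t)}\sum_{p\in P}\phi_T(p,t)\,p$. Merge: run $A$ on the points $\pi(t)$ with weights $w(t)$ to obtain a set $S$ of at most $k$ centers, compute a cheapest fair fractional assignment $\phi$ of $P$ to $S$, and return $(S,\phi)$. There is an absolute constant $C>0$, and for every $d$ a constant $K\in\mathbb{N}$ depending only on $d$, such that the following holds for every such instance in $\mathbb{R}^d$. 1. There is an $\varepsilon$-approximate centroid set $T$ of $P$ with $|T|\le(Kn/\varepsilon)^K$, and the algorithm can be carried out with every finite $\varepsilon$-approximate centroid set $T$. 2. Every pair $(S,\phi)$ that the algorithm can return is a fractional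 solution of $(\alpha,\beta)$-fair $k$-means with $$\mathrm{Cost}(S,\phi)\le(1+4\rho+C\rho\varepsilon)\cdot OPT.$$ 3. For every such $(S,\phi)$ there is an integral assignment $\psi$ of $P$ to $S$ with $\mathrm{Cost}(S,\psi)\le\mathrm{Cost}(S,\phi)$ and violation $3\Delta+4$, where $\Delta$ is the maximum number of groups that a point of $P$ belongs to. If the groups are pairwise disjoint, there is also such a $\psi$ with violation $2$. -/

import Mathlib

open scoped BigOperators

/-- The `d`-dimensional Euclidean space. -/
abbrev Pt (d : ℕ) : Type := EuclideanSpace ℝ (Fin d)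

/-- An instance of `(α, β)`-fair `k`-means: a finite set of points in Euclidean space, which is the
union of `m` (possibly overlapping) groups, a bound `k` on the number of centers, and the vectors
`α, β ∈ [0,1]^m`. -/
structure FairInstance (d m : ℕ) where
  points : Finset (Pt d)
  groups : Fin m → Finset (Pt d)
  mem_points_iff : ∀ p, p ∈ points ↔ ∃ i, p ∈ groups i
  k : ℕ
  α : Fin m → ℝ
  β : Fin m → ℝ
  α_mem : ∀ i, α i ∈ Set.Icc (0 : ℝ) 1
  β_mem : ∀ i, β i ∈ Set.Icc (0 : ℝ) 1

/-- `weightOn A φ s` is the weight that the points of `A` send to the center `s` under the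
assignment `φ`. -/
noncomputable def weightOn {d : ℕ} (A : Finset (Pt d)) (φ : Pt d → Pt d → ℝ) (s : Pt d) : ℝ :=
  ∑ p ∈ A, φ p s

namespace FairInstance

variable {d m : ℕ}

/-- `φ` is a fractional assignment of the points to the finite set `S` of centers. Only the values
of `φ` on `points × S` matter. -/
def IsAssignment (I : FairInstance d m) (S : Finset (Pt d)) (φ : Pt d → Pt d → ℝ) : Prop :=
  (∀ p ∈ I.points, ∀ s ∈ S, 0 ≤ φ p s) ∧ ∀ p ∈ I.points, ∑ s ∈ S, φ p s = 1

/-- `φ` is an integral assignment: all its entries are `0` or `1`. -/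
def IsIntegralAssignment (I : FairInstance d m) (S : Finset (Pt d)) (φ : Pt d → Pt d → ℝ) :
    Prop :=
  I.IsAssignment S φ ∧ ∀ p ∈ I.points, ∀ s ∈ S, φ p s = 0 ∨ φ p s = 1

/-- The fairness constraints hold up to an additive violation `lam` at every center. -/
def HasViolation (I : FairInstance d m) (lam : ℝ) (S : Finset (Pt d)) (φ : Pt d → Pt d → ℝ) :
    Prop :=
  ∀ s ∈ S, ∀ i,
    I.β i * weightOn I.points φ s - lam ≤ weightOn (I.groups i) φ s ∧
    weightOn (I.groups i) φ s ≤ I.α i * weightOn I.points φ s + lam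

/-- The fairness constraints hold exactly at every center. -/
def IsFair (I : FairInstance d m) (S : Finset (Pt d)) (φ : Pt d → Pt d → ℝ) : Prop :=
  ∀ s ∈ S, ∀ i,
    I.β i * weightOn I.points φ s ≤ weightOn (I.groups i) φ s ∧
    weightOn (I.groups i) φ s ≤ I.α i * weightOn I.points φ s

/-- The clustering cost of the centers `S` with the assignment `φ`. -/
noncomputable def cost (I : FairInstance d m) (S : Finset (Pt d)) (φ : Pt d → Pt d → ℝ) : ℝ :=
  ∑ p ∈ I.points, ∑ s ∈ S, ‖p - s‖ ^ 2 * φ p s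

/-- `(S, φ)` is a fractional solution of the fair `k`-means problem. -/
def IsFractionalSolution (I : FairInstance d m) (S : Finset (Pt d)) (φ : Pt d → Pt d → ℝ) :
    Prop :=
  S.card ≤ I.k ∧ I.IsAssignment S φ ∧ I.IsFair S φ

/-- `(S, φ)` is an integral solution of the fair `k`-means problem. -/
def IsIntegralSolution (I : FairInstance d m) (S : Finset (Pt d)) (φ : Pt d → Pt d → ℝ) :
    Prop :=
  S.card ≤ I.k ∧ I.IsIntegralAssignment S φ ∧ I.IsFair S φ

/-- The problem has an integral solution. -/
def Feasible (I : FairInstance d m) : Prop :=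
  ∃ S φ, I.IsIntegralSolution S φ

/-- The optimal integral cost (meaningful for feasible instances). -/
noncomputable def opt (I : FairInstance d m) : ℝ :=
  sInf {c : ℝ | ∃ S φ, I.IsIntegralSolution S φ ∧ c = I.cost S φ}

/-- `φ` is an optimal solution of the linear program that asks, for the fixed set `S` of centers,
for a cheapest fractional assignment that satisfies the fairness constraints. -/
def IsOptimalAssignment (I : FairInstance d m) (S : Finset (Pt d)) (φ : Pt d → Pt d → ℝ) :
    Prop :=
  (I.IsAssignment S φ ∧ I.IsFair S φ) ∧
    ∀ ψ, I.IsAssignment S ψ → I.IsFair S ψ → I.cost S φ ≤ I.cost S ψ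

open Classical in
/-- The maximum number of groups that a point belongs to. -/
noncomputable def maxGroups (I : FairInstance d m) : ℕ :=
  I.points.sup fun p => (Finset.univ.filter fun i => p ∈ I.groups i).card

end FairInstance

/-- The centroid of a (nonempty) finite set. -/
noncomputable def centroidOf {d : ℕ} (Q : Finset (Pt d)) : Pt d :=
  (Q.card : ℝ)⁻¹ • ∑ q ∈ Q, q

/-- `T` is an `ε`-approximate centroid set of `P`. -/
def IsApproxCentroidSet {d : ℕ} (ε : ℝ) (P T : Finset (Pt d)) : Prop :=
  ∀ Q ⊆ P, Q.Nonempty → ∃ v ∈ T,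
    ‖v - centroidOf Q‖ ≤
      ε / 3 * Real.sqrt ((Q.card : ℝ)⁻¹ * ∑ q ∈ Q, ‖q - centroidOf Q‖ ^ 2)

/-- The vanilla `k`-means cost of the nonempty center set `S` on the finite set `Q` with weights
`w`. -/
noncomputable def kMeansCost {d : ℕ} (Q : Finset (Pt d)) (w : Pt d → ℝ) (S : Finset (Pt d)) : ℝ :=
  ∑ q ∈ Q, w q * Metric.infDist q (S : Set (Pt d)) ^ 2

/-- A vanilla `k`-means algorithm, as an input-output map: it maps a finite set of points, their
weights and the number `k` to a set of centers. -/
abbrev KMeansAlgorithm (d : ℕ) : Type :=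
  Finset (Pt d) → (Pt d → ℝ) → ℕ → Finset (Pt d)

/-- The vanilla `k`-means algorithm `A` is `ρ`-approximate: on every nonempty finite set with
positive weights and every `k ≥ 1`, it returns at least one and at most `k` centers, and their
cost is at most `ρ` times the cost of any such set of centers. -/
def IsApproxKMeans {d : ℕ} (ρ : ℝ) (A : KMeansAlgorithm d) : Prop :=
  ∀ (Q : Finset (Pt d)) (w : Pt d → ℝ) (k : ℕ), Q.Nonempty → (∀ q ∈ Q, 0 < w q) → 1 ≤ k →
    (A Q w k).Nonempty ∧ (A Q w k).card ≤ k ∧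
      ∀ S : Finset (Pt d), S.Nonempty → S.card ≤ k →
        kMeansCost Q w (A Q w k) ≤ ρ * kMeansCost Q w S

namespace FairInstance

variable {d m : ℕ}

/-- The centroid `π(t)` of the (fractional) cluster that `φ` assigns to `t`. -/
noncomputable def adjust (I : FairInstance d m) (φ : Pt d → Pt d → ℝ) (t : Pt d) : Pt d :=
  (weightOn I.points φ t)⁻¹ • ∑ p ∈ I.points, φ p t • p

open Classical in
/-- The set `π(T)` of adjusted centers; a center `t` that receives no weight has no centroid and is
left out. -/
noncomputable def adjustedSet (I : FairInstance d m) (T : Finset (Pt d))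
    (φ : Pt d → Pt d → ℝ) : Finset (Pt d) :=
  (T.filter fun t => 0 < weightOn I.points φ t).image (I.adjust φ)

open Classical in
/-- The weight of a point of `π(T)`: the total weight of the centers `t` moved to it. -/
noncomputable def adjustedWeight (I : FairInstance d m) (T : Finset (Pt d))
    (φ : Pt d → Pt d → ℝ) (q : Pt d) : ℝ :=
  ∑ t ∈ T.filter fun t => 0 < weightOn I.points φ t ∧ I.adjust φ t = q, weightOn I.points φ t

/-- `(S, φ)` is a possible output of the Relax-and-Merge algorithm with the vanilla `k`-means
algorithm `A`, when the `ε`-approximate centroid set constructed in its first step is `T`: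
* relax: take an `ε`-approximate centroid set `T` of the points, solve the linear program on `T`
  and move every `t ∈ T` to the centroid of what is assigned to it;
* merge: run `A` on the weighted moved centers to get `S`, and solve the linear program on `S`.
The linear programs may have several optimal solutions; any of them may be used. -/
def IsRelaxAndMergeOutput (I : FairInstance d m) (A : KMeansAlgorithm d) (ε : ℝ)
    (T S : Finset (Pt d)) (φ : Pt d → Pt d → ℝ) : Prop :=
  IsApproxCentroidSet ε I.points T ∧
  ∃ φT : Pt d → Pt d → ℝ, I.IsOptimalAssignment T φT ∧
    S = A (I.adjustedSet T φT) (I.adjustedWeight T φT) I.k ∧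
    I.IsOptimalAssignment S φ

end FairInstance

/-!
Let `(S*, φ*)` be an integral solution of cost `c`. Each of its clusters can be moved to the point
of `T` near its centroid, which costs at most a factor `1 + ε²/9`; fairness is preserved whenever
centers are merged, its constraints being additive (`IsFair.reassign`). So the relaxed optimum
`φ_T` costs at most `(1 + ε²/9) c`, and moving every `t` to its centroid `π(t)` only lowers this, to
some `c₁`. The vanilla cost of `S*` on the weighted points `π(t)` is at most `2 c₁ + 2 c`: a point
`p` that sends weight to `t` is at distance `‖p - π(t)‖` from `π(t)` and is itself served by `S*`.
Hence `A` returns centers `S` of vanilla cost at most `ρ (2 c₁ + 2 c)`. Passing the weight of each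
`t` on to the center of `S` nearest to `π(t)` is fair, and since `π(t)` is the centroid of what is
sent to `t`, the cost is exactly `c₁` plus the vanilla cost of `S`. This gives the factor
`1 + 4ρ + O(ρε)` (`IsRelaxAndMergeOutput.cost_le`).

A small centroid set is a union of grids, one for each pair of points (`gridSet`). If `D` is the
diameter of `Q`, the centroid of `Q` is at distance at most `D` from a point of `Q`, and the
standard deviation of `Q` is at least `D / √(2n)`, so that a grid of width of order `ε D / n` is fine
enough.

The rounding is iterative (`exists_integral_rounding`): as long as the fractional variables admit
a direction in which all active constraints stay fixed, one moves along it, without raising the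
cost, until another quantity becomes integral. Such a direction exists when there are fewer
independent active constraints than fractional variables. Every point with a fractional variable
has two of them, so the row constraints number at most half the variables. For overlapping groups,
a group constraint is dropped when it has at most `2Δ + 3` fractional variables, and the constraint
on the size of a cluster when it has at most `Δ + 1`; the others number at most half the variables,
by distributing the variables among them. The total violation is then at most
`(2Δ + 3) + (Δ + 1) = 3Δ + 4`. For disjoint groups, groups and clusters form a laminar family, and
all their weights can be kept between the floor and the ceiling of the initial ones, only integral
weights being active; the total violation is at most `1 + 1 = 2`. If there are as many constraints as
variables, they are dependent, since the rows and the clusters then both add up to all variables.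
-/

/-! ### Iterative rounding -/

/-- Moving along a direction `b` from a point `a`, all of whose integral coordinates are fixed by
`b`, one can stop as soon as a further coordinate becomes integral; up to then no coordinate
passes an integer. -/
lemma exists_step_to_integer {ι : Type*} (J : Finset ι) (a b : ι → ℝ)
    (hb : ∀ j ∈ J, (∃ z : ℤ, a j = z) → b j = 0) (hne : ∃ j ∈ J, b j ≠ 0) :
    ∃ t : ℝ, 0 ≤ t ∧
      (∀ j ∈ J, (⌊a j⌋ : ℝ) ≤ a j + t * b j ∧ a j + t * b j ≤ (⌈a j⌉ : ℝ)) ∧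
      ∃ j ∈ J, (¬ ∃ z : ℤ, a j = z) ∧ ∃ z : ℤ, a j + t * b j = z := by
  classical
  let τ : ι → ℝ := fun j => if 0 < b j then (⌈a j⌉ - a j) / b j else (a j - ⌊a j⌋) / (-b j)
  have hτ : ∀ j, 0 ≤ τ j := by
    intro j
    simp only [τ]
    split_ifs with h
    · exact div_nonneg (sub_nonneg.2 (Int.le_ceil _)) h.le
    · exact div_nonneg (sub_nonneg.2 (Int.floor_le _)) (by linarith)
  obtain ⟨j₀, hj₀, hmin⟩ := Finset.exists_min_image (J.filter fun j => b j ≠ 0) τ (by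
    obtain ⟨j, hj, h⟩ := hne
    exact ⟨j, Finset.mem_filter.2 ⟨hj, h⟩⟩)
  obtain ⟨hj₀J, hj₀b⟩ := Finset.mem_filter.1 hj₀
  refine ⟨τ j₀, hτ j₀, ?_, j₀, hj₀J, fun h => hj₀b (hb j₀ hj₀J h), ?_⟩
  · intro j hj
    by_cases hbj : b j = 0
    · simp [hbj, Int.floor_le, Int.le_ceil]
    have h1 := hmin j (Finset.mem_filter.2 ⟨hj, hbj⟩)
    have h2 := hτ j₀
    have hf := Int.floor_le (a j)
    have hc := Int.le_ceil (a j)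
    rcases lt_or_gt_of_ne hbj with hneg | hpos
    · have h3 : τ j * (-b j) = a j - ⌊a j⌋ := by
        simp only [τ, if_neg hneg.not_gt]
        field_simp
      constructor <;> nlinarith
    · have h3 : τ j * b j = ⌈a j⌉ - a j := by
        simp only [τ, if_pos hpos]
        field_simp
      constructor <;> nlinarith
  · rcases lt_or_gt_of_ne hj₀b with hneg | hpos
    · refine ⟨⌊a j₀⌋, ?_⟩
      simp only [τ, if_neg hneg.not_gt]
      field_simp
      ring
    · refine ⟨⌈a j₀⌉, ?_⟩
      simp only [τ, if_pos hpos]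
      field_simp
      ring

open Classical in
/-- The variables in `D` at which `x` is different from `0` and `1`. -/
noncomputable def fracSupport {E : Type*} (D : Finset E) (x : E → ℝ) : Finset E :=
  D.filter fun e => x e ≠ 0 ∧ x e ≠ 1

lemma mem_fracSupport {E : Type*} {D : Finset E} {x : E → ℝ} {e : E} :
    e ∈ fracSupport D x ↔ e ∈ D ∧ x e ≠ 0 ∧ x e ≠ 1 := by
  simp [fracSupport]

lemma not_integer_of_frac {t : ℝ} (h0 : 0 ≤ t) (h1 : t ≤ 1) (hn0 : t ≠ 0) (hn1 : t ≠ 1) :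
    ¬ ∃ z : ℤ, t = z := by
  rintro ⟨z, rfl⟩
  have h0' : (0 : ℤ) ≤ z := by exact_mod_cast h0
  have h1' : z ≤ (1 : ℤ) := by exact_mod_cast h1
  have hn0' : z ≠ 0 := by exact_mod_cast hn0
  have hn1' : z ≠ 1 := by exact_mod_cast hn1
  omega

/-- The rounding scheme. The sums over the sets in `U` never pass an integer, and become fixed once
they are integral; the sum over a set `A` with `V A n` is fixed as long as `A` has more than `n`
fractional variables. If these requirements always leave a direction in which the fractional
variables can move, then `x₀` can be rounded to an integral point without raising the linear
cost `w`, and the sum over a set `A` with `V A n` changes by at most `n`. -/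
theorem exists_integral_rounding {E : Type*} [DecidableEq E] (D : Finset E) (U : Finset (Finset E))
    (V : Finset E → ℕ → Prop) (x₀ w : E → ℝ) (hV : ∀ A n, V A n → A ⊆ D)
    (hx₀ : ∀ e ∈ D, 0 ≤ x₀ e ∧ x₀ e ≤ 1)
    (H : ∀ x : E → ℝ, (∀ e ∈ D, 0 ≤ x e ∧ x e ≤ 1) →
      (∀ A ∈ U, (⌊∑ e ∈ A, x₀ e⌋ : ℝ) ≤ ∑ e ∈ A, x e ∧
        ∑ e ∈ A, x e ≤ (⌈∑ e ∈ A, x₀ e⌉ : ℝ)) →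
      (fracSupport D x).Nonempty →
      ∃ y : E → ℝ, (∃ e, y e ≠ 0) ∧ (∀ e, e ∉ fracSupport D x → y e = 0) ∧
        (∀ A ∈ U, (∃ z : ℤ, ∑ e ∈ A, x e = z) → ∑ e ∈ A, y e = 0) ∧
        ∀ A n, V A n → n < (A.filter (· ∈ fracSupport D x)).card → ∑ e ∈ A, y e = 0) :
    ∃ ψ : E → ℝ, (∀ e ∈ D, ψ e = 0 ∨ ψ e = 1) ∧
      (∀ A ∈ U, (⌊∑ e ∈ A, x₀ e⌋ : ℝ) ≤ ∑ e ∈ A, ψ e ∧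
        ∑ e ∈ A, ψ e ≤ (⌈∑ e ∈ A, x₀ e⌉ : ℝ)) ∧
      (∀ A n, V A n → |∑ e ∈ A, ψ e - ∑ e ∈ A, x₀ e| ≤ n) ∧
      ∑ e ∈ D, w e * ψ e ≤ ∑ e ∈ D, w e * x₀ e := by
  classical
  -- A variable is treated as the sum over a singleton.
  let W : Finset (Finset E) := U ∪ D.image fun e => {e}
  have hsing : ∀ e ∈ D, {e} ∈ W := fun e he =>
    Finset.mem_union_right _ (Finset.mem_image_of_mem (fun e => ({e} : Finset E)) he)
  suffices key : ∀ N : ℕ, ∀ x : E → ℝ,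
      (W.filter fun A => ¬ ∃ z : ℤ, ∑ e ∈ A, x e = z).card = N →
      (∀ e ∈ D, 0 ≤ x e ∧ x e ≤ 1) →
      (∀ A ∈ U, (⌊∑ e ∈ A, x₀ e⌋ : ℝ) ≤ ∑ e ∈ A, x e ∧
        ∑ e ∈ A, x e ≤ (⌈∑ e ∈ A, x₀ e⌉ : ℝ)) →
      ∃ ψ : E → ℝ, (∀ e ∈ D, ψ e = 0 ∨ ψ e = 1) ∧
        (∀ e ∈ D, e ∉ fracSupport D x → ψ e = x e) ∧
        (∀ A ∈ U, (⌊∑ e ∈ A, x₀ e⌋ : ℝ) ≤ ∑ e ∈ A, ψ e ∧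
          ∑ e ∈ A, ψ e ≤ (⌈∑ e ∈ A, x₀ e⌉ : ℝ)) ∧
        (∀ A n, V A n → |∑ e ∈ A, ψ e - ∑ e ∈ A, x e| ≤ n) ∧
        ∑ e ∈ D, w e * ψ e ≤ ∑ e ∈ D, w e * x e by
    obtain ⟨ψ, h1, -, h2, h3, h4⟩ := key _ x₀ rfl hx₀
      (fun A _ => ⟨Int.floor_le _, Int.le_ceil _⟩)
    exact ⟨ψ, h1, h2, h3, h4⟩
  intro N
  induction N using Nat.strong_induction_on with
  | _ N ih =>
  intro x hN hx hU
  rcases (fracSupport D x).eq_empty_or_nonempty with hF | hF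
  · refine ⟨x, fun e he => ?_, fun _ _ _ => rfl, hU, fun A n _ => by simp, le_rfl⟩
    by_contra! hcon
    have : e ∈ fracSupport D x := mem_fracSupport.2 ⟨he, hcon⟩
    simp [hF] at this
  -- Choose the sign of the direction so that the cost does not increase.
  obtain ⟨y, ⟨e₀, he₀⟩, hyF, hyU, hyV, hyw⟩ : ∃ y : E → ℝ, (∃ e, y e ≠ 0) ∧
      (∀ e, e ∉ fracSupport D x → y e = 0) ∧
      (∀ A ∈ U, (∃ z : ℤ, ∑ e ∈ A, x e = z) → ∑ e ∈ A, y e = 0) ∧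
      (∀ A n, V A n → n < (A.filter (· ∈ fracSupport D x)).card → ∑ e ∈ A, y e = 0) ∧
      ∑ e ∈ D, w e * y e ≤ 0 := by
    obtain ⟨y, ⟨e₀, he₀⟩, h1, h2, h3⟩ := H x hx hU hF
    rcases le_total (∑ e ∈ D, w e * y e) 0 with h | h
    · exact ⟨y, ⟨e₀, he₀⟩, h1, h2, h3, h⟩
    · refine ⟨fun e => -y e, ⟨e₀, neg_ne_zero.2 he₀⟩, fun e he => by simp [h1 e he],
        fun A hA hz => by simp [h2 A hA hz], fun A n hA hn => by simp [h3 A n hA hn], ?_⟩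
      simpa using h
  have he₀F : e₀ ∈ fracSupport D x := by
    by_contra h
    exact he₀ (hyF e₀ h)
  have hyW : ∀ A ∈ W, (∃ z : ℤ, ∑ e ∈ A, x e = z) → ∑ e ∈ A, y e = 0 := by
    intro A hA hz
    rcases Finset.mem_union.1 hA with hA | hA
    · exact hyU A hA hz
    · obtain ⟨e, he, rfl⟩ := Finset.mem_image.1 hA
      simp only [Finset.sum_singleton] at hz ⊢
      apply hyF
      intro hef
      obtain ⟨-, hn0, hn1⟩ := mem_fracSupport.1 hef
      exact not_integer_of_frac (hx e he).1 (hx e he).2 hn0 hn1 hz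
  obtain ⟨t, ht, htW, A₀, hA₀, hA₀n, hA₀z⟩ := exists_step_to_integer W
    (fun A => ∑ e ∈ A, x e) (fun A => ∑ e ∈ A, y e) hyW
    ⟨{e₀}, hsing e₀ (mem_fracSupport.1 he₀F).1, by simpa using he₀⟩
  let x' : E → ℝ := fun e => x e + t * y e
  have hsum : ∀ A : Finset E, ∑ e ∈ A, x' e = ∑ e ∈ A, x e + t * ∑ e ∈ A, y e := by
    intro A
    simp [x', Finset.sum_add_distrib, Finset.mul_sum]
  simp only [← hsum] at htW hA₀z
  have hx'F : ∀ e, e ∉ fracSupport D x → x' e = x e := by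
    intro e he
    simp [x', hyF e he]
  have hx'01 : ∀ e ∈ D, 0 ≤ x' e ∧ x' e ≤ 1 := by
    intro e he
    have h := htW {e} (hsing e he)
    simp only [Finset.sum_singleton] at h
    have h0 : (0 : ℤ) ≤ ⌊x e⌋ := Int.floor_nonneg.2 (hx e he).1
    have h1 : ⌈x e⌉ ≤ (1 : ℤ) := Int.ceil_le.2 (by simpa using (hx e he).2)
    have h0' : (0 : ℝ) ≤ ⌊x e⌋ := by exact_mod_cast h0
    have h1' : (⌈x e⌉ : ℝ) ≤ 1 := by exact_mod_cast h1
    exact ⟨h0'.trans h.1, h.2.trans h1'⟩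
  have hx'U : ∀ A ∈ U, (⌊∑ e ∈ A, x₀ e⌋ : ℝ) ≤ ∑ e ∈ A, x' e ∧
      ∑ e ∈ A, x' e ≤ (⌈∑ e ∈ A, x₀ e⌉ : ℝ) := by
    intro A hA
    have h := htW A (Finset.mem_union_left _ hA)
    have h0 : ⌊∑ e ∈ A, x₀ e⌋ ≤ ⌊∑ e ∈ A, x e⌋ := Int.le_floor.2 (hU A hA).1
    have h1 : ⌈∑ e ∈ A, x e⌉ ≤ ⌈∑ e ∈ A, x₀ e⌉ := Int.ceil_le.2 (hU A hA).2
    have h0' : (⌊∑ e ∈ A, x₀ e⌋ : ℝ) ≤ ⌊∑ e ∈ A, x e⌋ := by exact_mod_cast h0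
    have h1' : (⌈∑ e ∈ A, x e⌉ : ℝ) ≤ ⌈∑ e ∈ A, x₀ e⌉ := by exact_mod_cast h1
    exact ⟨h0'.trans h.1, h.2.trans h1'⟩
  have hx'w : ∑ e ∈ D, w e * x' e ≤ ∑ e ∈ D, w e * x e := by
    have : ∑ e ∈ D, w e * x' e = ∑ e ∈ D, w e * x e + t * ∑ e ∈ D, w e * y e := by
      rw [Finset.mul_sum, ← Finset.sum_add_distrib]
      exact Finset.sum_congr rfl fun e _ => by simp only [x']; ring
    rw [this]
    nlinarith [mul_nonneg ht (neg_nonneg.2 hyw)]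
  have hlt : (W.filter fun A => ¬ ∃ z : ℤ, ∑ e ∈ A, x' e = z).card < N := by
    rw [← hN]
    apply Finset.card_lt_card
    rw [Finset.ssubset_iff_of_subset]
    · exact ⟨A₀, Finset.mem_filter.2 ⟨hA₀, hA₀n⟩, fun h => (Finset.mem_filter.1 h).2 hA₀z⟩
    · intro A hA
      obtain ⟨hA, hz⟩ := Finset.mem_filter.1 hA
      refine Finset.mem_filter.2 ⟨hA, fun h => hz ?_⟩
      rw [hsum, hyW A hA h, mul_zero, add_zero]
      exact h
  obtain ⟨ψ, h1, h2, h3, h4, h5⟩ := ih _ hlt x' rfl hx'01 hx'U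
  have hψF : ∀ e ∈ D, e ∉ fracSupport D x → ψ e = x e := by
    intro e he hef
    rw [h2 e he, hx'F e hef]
    intro h
    rw [mem_fracSupport, hx'F e hef] at h
    exact hef (mem_fracSupport.2 h)
  refine ⟨ψ, h1, hψF, h3, ?_, h5.trans hx'w⟩
  intro A n hA
  rcases lt_or_ge n (A.filter (· ∈ fracSupport D x)).card with hn | hn
  · have := h4 A n hA
    rwa [hsum, hyV A n hA hn, mul_zero, add_zero] at this
  · rw [← Finset.sum_sub_distrib]
    calc |∑ e ∈ A, (ψ e - x e)|
        = |∑ e ∈ A.filter (· ∈ fracSupport D x), (ψ e - x e)| := by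
          rw [Finset.sum_filter_of_ne]
          intro e he hne
          by_contra h
          exact hne (by rw [hψF e (hV A n hA he) h, sub_self])
      _ ≤ ∑ e ∈ A.filter (· ∈ fracSupport D x), |ψ e - x e| := Finset.abs_sum_le_sum_abs _ _
      _ ≤ ∑ e ∈ A.filter (· ∈ fracSupport D x), (1 : ℝ) := by
          refine Finset.sum_le_sum fun e he => ?_
          have heD := hV A n hA (Finset.mem_filter.1 he).1
          have hxe := hx e heD
          rcases h1 e heD with h | h <;> rw [h, abs_le] <;> constructor <;> linarith
      _ ≤ n := by
          simpa using hn

/-! ### Directions that satisfy the active constraints -/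

/-- Fewer homogeneous equations than variables have a nonzero solution. -/
lemma exists_direction_of_card_lt {E κ : Type*} (F : Finset E) (K : Finset κ)
    (W : κ → Finset E) (h : K.card < F.card) :
    ∃ y : E → ℝ, (∃ e, y e ≠ 0) ∧ (∀ e, e ∉ F → y e = 0) ∧ ∀ k ∈ K, ∑ e ∈ W k, y e = 0 := by
  classical
  let ext : (F → ℝ) →ₗ[ℝ] (E → ℝ) :=
    { toFun := fun v e => if he : e ∈ F then v ⟨e, he⟩ else 0
      map_add' := by
        intro u v
        ext e
        by_cases he : e ∈ F <;> simp [he]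
      map_smul' := by
        intro r v
        ext e
        by_cases he : e ∈ F <;> simp [he] }
  let f : (F → ℝ) →ₗ[ℝ] (K → ℝ) :=
    LinearMap.pi fun k => ∑ e ∈ W k.1, (LinearMap.proj e).comp ext
  have hker : LinearMap.ker f ≠ ⊥ := LinearMap.ker_ne_bot_of_finrank_lt (by simpa using h)
  obtain ⟨v, hv, hv0⟩ := Submodule.exists_mem_ne_zero_of_ne_bot hker
  obtain ⟨e, he⟩ := Function.ne_iff.1 hv0
  refine ⟨ext v, ⟨e.1, by simpa [ext] using he⟩, fun e he => by simp [ext, he], fun k hk => ?_⟩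
  have := congrFun (LinearMap.mem_ker.1 hv) ⟨k, hk⟩
  simpa [f] using this

open Classical in
/-- In a bipartite setting in which every row that meets `F` does so at least twice, the row
equations can be solved together with at most `|F| / 2` further equations `W k`. When there are
exactly `|F| / 2` of these, one equation has to be redundant; this is so if the `W k` imply that
the sum of all variables, which is the sum of all rows, vanishes. -/
lemma exists_direction_of_rows {α β κ : Type*} (F : Finset (α × β)) (hF : F.Nonempty)
    (hrow : ∀ e ∈ F, ∃ e' ∈ F, e' ≠ e ∧ e'.1 = e.1)
    (K : Finset κ) (W : κ → Finset (α × β)) (hK : 2 * K.card ≤ F.card)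
    (htight : 2 * K.card = F.card → ∀ y : α × β → ℝ, (∀ e, e ∉ F → y e = 0) →
      (∀ k ∈ K, ∑ e ∈ W k, y e = 0) → ∑ e ∈ F, y e = 0) :
    ∃ y : α × β → ℝ, (∃ e, y e ≠ 0) ∧ (∀ e, e ∉ F → y e = 0) ∧
      (∀ a, ∑ e ∈ F.filter (fun e => e.1 = a), y e = 0) ∧ ∀ k ∈ K, ∑ e ∈ W k, y e = 0 := by
  let R : Finset α := F.image Prod.fst
  have hR : 2 * R.card ≤ F.card := by
    refine Finset.mul_card_image_le_card F 2 fun a ha => ?_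
    obtain ⟨e, he, rfl⟩ := Finset.mem_image.1 ha
    obtain ⟨e', he', hne, h1⟩ := hrow e he
    rw [Nat.succ_le_iff, Finset.one_lt_card]
    exact ⟨e, by simp [he], e', by simp [he', h1], hne.symm⟩
  -- Drop the equation of one row, and recover it in the case where it is needed.
  obtain ⟨e₀, he₀⟩ := hF
  let a₀ := e₀.1
  have ha₀ : a₀ ∈ R := Finset.mem_image_of_mem _ he₀
  have houtside : ∀ (y : α × β → ℝ) (a : α), a ∉ R →
      ∑ e ∈ F.filter (fun e => e.1 = a), y e = 0 := by
    intro y a ha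
    rw [Finset.filter_eq_empty_iff.2, Finset.sum_empty]
    intro e he h
    exact ha (h ▸ Finset.mem_image_of_mem _ he)
  let W' : α ⊕ κ → Finset (α × β) := Sum.elim (fun a => F.filter (fun e => e.1 = a)) W
  by_cases hlt : R.card + K.card < F.card
  · obtain ⟨y, h1, h2, h3⟩ := exists_direction_of_card_lt F (R.disjSum K) W'
      (by rwa [Finset.card_disjSum])
    refine ⟨y, h1, h2, fun a => ?_, fun k hk => h3 (Sum.inr k) (by simpa using hk)⟩
    by_cases ha : a ∈ R
    · exact h3 (Sum.inl a) (by simpa using ha)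
    · exact houtside y a ha
  · obtain ⟨y, h1, h2, h3⟩ := exists_direction_of_card_lt F ((R.erase a₀).disjSum K) W'
      (by
        rw [Finset.card_disjSum, Finset.card_erase_of_mem ha₀]
        have := Finset.card_pos.2 ⟨a₀, ha₀⟩
        omega)
    have hKy : ∀ k ∈ K, ∑ e ∈ W k, y e = 0 := fun k hk => h3 (Sum.inr k) (by simpa using hk)
    have hother : ∀ a, a ≠ a₀ → ∑ e ∈ F.filter (fun e => e.1 = a), y e = 0 := by
      intro a hne
      by_cases ha : a ∈ R
      · exact h3 (Sum.inl a) (by simp [ha, hne])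
      · exact houtside y a ha
    refine ⟨y, h1, h2, fun a => ?_, hKy⟩
    by_cases ha : a = a₀
    · subst ha
      have htot := htight (by omega) y h2 hKy
      rw [← Finset.sum_fiberwise_of_maps_to (g := Prod.fst) (t := R)
        (fun e he => Finset.mem_image_of_mem _ he)] at htot
      rwa [Finset.sum_eq_single a₀ (fun a _ hne => hother a hne) (fun h => absurd ha₀ h)] at htot
    · exact hother a ha

/-- A fractional variable in a set with integral sum is not the only one. -/
lemma exists_ne_frac_of_sum_integer {E : Type*} {D A : Finset E} {x : E → ℝ} (hA : A ⊆ D)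
    (hx : ∀ e ∈ D, 0 ≤ x e ∧ x e ≤ 1) (hz : ∃ z : ℤ, ∑ e ∈ A, x e = z) {e : E} (he : e ∈ A)
    (hef : e ∈ fracSupport D x) : ∃ e' ∈ A, e' ∈ fracSupport D x ∧ e' ≠ e := by
  classical
  by_contra! hcon
  obtain ⟨heD, hn0, hn1⟩ := mem_fracSupport.1 hef
  refine not_integer_of_frac (hx e heD).1 (hx e heD).2 hn0 hn1 ?_
  obtain ⟨z, hz⟩ := hz
  have hrest : ∃ z' : ℤ, ∑ e' ∈ A.erase e, x e' = z' := by
    have hint : ∀ e' ∈ A.erase e, ∃ z' : ℤ, x e' = z' := by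
      intro e' he'
      obtain ⟨hne, he'A⟩ := Finset.mem_erase.1 he'
      by_contra h
      refine hne (hcon e' he'A (mem_fracSupport.2 ⟨hA he'A, ?_, ?_⟩))
      · exact fun h0 => h ⟨0, by simpa using h0⟩
      · exact fun h1 => h ⟨1, by simpa using h1⟩
    choose! g hg using hint
    exact ⟨∑ e' ∈ A.erase e, g e', by rw [Finset.sum_congr rfl hg]; push_cast; rfl⟩
  obtain ⟨z', hz'⟩ := hrest
  refine ⟨z - z', ?_⟩
  have := Finset.add_sum_erase A x he
  push_cast
  linarith

lemma sum_eq_sum_filter_mem {E : Type*} [DecidableEq E] {F : Finset E} {y : E → ℝ}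
    (hy : ∀ e, e ∉ F → y e = 0) (A : Finset E) :
    ∑ e ∈ A, y e = ∑ e ∈ F.filter (· ∈ A), y e := by
  rw [Finset.filter_mem_eq_inter, Finset.inter_comm]
  symm
  apply Finset.sum_subset Finset.inter_subset_left
  intro e he hn
  exact hy e fun h => hn (Finset.mem_inter.2 ⟨he, h⟩)

/-! ### Rounding assignments -/

/-- A fractional assignment of `P` to `S`, as a function of pairs. -/
structure IsPairAssignment {α β : Type*} (P : Finset α) (S : Finset β) (x : α × β → ℝ) : Prop where
  mem_unit : ∀ e ∈ P ×ˢ S, 0 ≤ x e ∧ x e ≤ 1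
  row_sum : ∀ p ∈ P, ∑ e ∈ {p} ×ˢ S, x e = 1

lemma IsPairAssignment.exists_ne_frac_row {α β : Type*} {P : Finset α} {S : Finset β}
    {x : α × β → ℝ} (hx : IsPairAssignment P S x) {e : α × β} (he : e ∈ fracSupport (P ×ˢ S) x) :
    ∃ e' ∈ fracSupport (P ×ˢ S) x, e' ≠ e ∧ e'.1 = e.1 := by
  have heD := Finset.mem_product.1 (mem_fracSupport.1 he).1
  obtain ⟨e', he', h1, h2⟩ := exists_ne_frac_of_sum_integer (A := {e.1} ×ˢ S)
    (Finset.product_subset_product_left (by simpa using heD.1)) hx.mem_unit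
    ⟨1, by simpa using hx.row_sum _ heD.1⟩ (by simpa using heD.2) he
  exact ⟨e', h1, h2, by simpa using (Finset.mem_product.1 he').1⟩

open Classical in
lemma sum_row_eq_sum_filter {α β : Type*} {P : Finset α} {S : Finset β} {x y : α × β → ℝ}
    (hy : ∀ e, e ∉ fracSupport (P ×ˢ S) x → y e = 0) (p : α) :
    ∑ e ∈ {p} ×ˢ S, y e = ∑ e ∈ (fracSupport (P ×ˢ S) x).filter (fun e => e.1 = p), y e := by
  rw [sum_eq_sum_filter_mem hy]
  refine Finset.sum_congr (Finset.filter_congr fun e he => ?_) fun _ _ => rfl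
  have := Finset.mem_product.1 (mem_fracSupport.1 he).1
  simp only [Finset.mem_product, Finset.mem_singleton, this.2, and_true]

open Classical in
lemma sum_column_eq_sum_filter {α β : Type*} {P : Finset α} {S : Finset β} {x y : α × β → ℝ}
    (hy : ∀ e, e ∉ fracSupport (P ×ˢ S) x → y e = 0) (s : β) :
    ∑ e ∈ P ×ˢ {s}, y e = ∑ e ∈ (fracSupport (P ×ˢ S) x).filter (fun e => e.2 = s), y e := by
  rw [sum_eq_sum_filter_mem hy]
  refine Finset.sum_congr (Finset.filter_congr fun e he => ?_) fun _ _ => rfl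
  have := Finset.mem_product.1 (mem_fracSupport.1 he).1
  simp only [Finset.mem_product, Finset.mem_singleton, this.1, true_and]

lemma IsPairAssignment.of_floor_ceil {α β : Type*} {P : Finset α} {S : Finset β}
    {x₀ x : α × β → ℝ} (hx₀ : IsPairAssignment P S x₀) (hx : ∀ e ∈ P ×ˢ S, 0 ≤ x e ∧ x e ≤ 1)
    (h : ∀ p ∈ P, (⌊∑ e ∈ {p} ×ˢ S, x₀ e⌋ : ℝ) ≤ ∑ e ∈ {p} ×ˢ S, x e ∧
      ∑ e ∈ {p} ×ˢ S, x e ≤ (⌈∑ e ∈ {p} ×ˢ S, x₀ e⌉ : ℝ)) :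
    IsPairAssignment P S x := by
  refine ⟨hx, fun p hp => ?_⟩
  have := h p hp
  simp only [hx₀.row_sum p hp, Int.floor_one, Int.ceil_one, Int.cast_one] at this
  exact le_antisymm this.2 this.1

/-- Rounding for overlapping groups. A fractional variable gives `1/2` to the equation of its row,
`1/(2Δ+4)` to each of the at most `Δ` group sums in its column, and `1/(Δ+2)` to the sum of its
column, `1` in total. As the sums with few fractional variables are not maintained, each equation
receives at least `1`. -/
theorem exists_integral_assignment_of_overlap {α β ι : Type*} [Fintype ι] {P : Finset α}
    {S : Finset β} (G : ι → Finset α) (hG : ∀ i, G i ⊆ P) (Δ : ℕ)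
    (hΔ : ∀ p ∈ P, ∀ J : Finset ι, (∀ i ∈ J, p ∈ G i) → J.card ≤ Δ) {x₀ : α × β → ℝ}
    (hx₀ : IsPairAssignment P S x₀) (w : α × β → ℝ) :
    ∃ ψ : α × β → ℝ, IsPairAssignment P S ψ ∧ (∀ e ∈ P ×ˢ S, ψ e = 0 ∨ ψ e = 1) ∧
      (∀ s ∈ S, ∀ i,
        |∑ e ∈ G i ×ˢ {s}, ψ e - ∑ e ∈ G i ×ˢ {s}, x₀ e| ≤ 2 * Δ + 3) ∧
      (∀ s ∈ S, |∑ e ∈ P ×ˢ {s}, ψ e - ∑ e ∈ P ×ˢ {s}, x₀ e| ≤ Δ + 1) ∧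
      ∑ e ∈ P ×ˢ S, w e * ψ e ≤ ∑ e ∈ P ×ˢ S, w e * x₀ e := by
  classical
  let U : Finset (Finset (α × β)) := P.image fun p => {p} ×ˢ S
  have hrowU : ∀ p ∈ P, {p} ×ˢ S ∈ U := fun p hp =>
    Finset.mem_image_of_mem (fun p => ({p} : Finset α) ×ˢ S) hp
  let V : Finset (α × β) → ℕ → Prop := fun A n =>
    (∃ s ∈ S, ∃ i, A = G i ×ˢ {s} ∧ n = 2 * Δ + 3) ∨ ∃ s ∈ S, A = P ×ˢ {s} ∧ n = Δ + 1
  have hV : ∀ A n, V A n → A ⊆ P ×ˢ S := by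
    rintro A n (⟨s, hs, i, rfl, -⟩ | ⟨s, hs, rfl, -⟩)
    · exact Finset.product_subset_product (hG i) (by simpa using hs)
    · exact Finset.product_subset_product_right (by simpa using hs)
  obtain ⟨ψ, h1, h2, h3, h4⟩ := exists_integral_rounding (P ×ˢ S) U V x₀ w hV hx₀.mem_unit (by
    intro x hx01 hxU hF
    have hx : IsPairAssignment P S x :=
      hx₀.of_floor_ceil hx01 fun p hp => hxU _ (hrowU p hp)
    set F := fracSupport (P ×ˢ S) x with hFdef
    have hFD : ∀ e ∈ F, e.1 ∈ P ∧ e.2 ∈ S := fun e he =>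
      Finset.mem_product.1 (mem_fracSupport.1 he).1
    let KG : Finset (β × ι) := (S ×ˢ Finset.univ).filter fun k =>
      2 * Δ + 3 < ((G k.2 ×ˢ {k.1}).filter (· ∈ F)).card
    let KT : Finset β := S.filter fun s => Δ + 1 < ((P ×ˢ {s}).filter (· ∈ F)).card
    let W : (β × ι) ⊕ β → Finset (α × β) :=
      Sum.elim (fun k => G k.2 ×ˢ {k.1}) fun s => P ×ˢ {s}
    have hKG : KG.card * (2 * Δ + 4) ≤ F.card * Δ := by
      refine Finset.card_mul_le_card_mul (fun k e => e ∈ G k.2 ×ˢ {k.1}) ?_ ?_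
      · intro k hk
        have := (Finset.mem_filter.1 hk).2
        rw [Finset.bipartiteAbove, Finset.filter_mem_eq_inter, Finset.inter_comm,
          ← Finset.filter_mem_eq_inter]
        omega
      · intro e he
        rw [Finset.bipartiteBelow]
        rw [← Finset.card_image_of_injOn (f := Prod.snd)]
        · refine hΔ e.1 (hFD e he).1 _ fun i hi => ?_
          obtain ⟨k, hk, rfl⟩ := Finset.mem_image.1 hi
          exact (Finset.mem_product.1 (Finset.mem_filter.1 hk).2).1
        · intro k hk k' hk' h
          have h1 := (Finset.mem_product.1 (Finset.mem_filter.1 hk).2).2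
          have h2 := (Finset.mem_product.1 (Finset.mem_filter.1 hk').2).2
          simp only [Finset.mem_singleton] at h1 h2
          exact Prod.ext (h1.symm.trans h2) h
    have hKT : (Δ + 2) * KT.card ≤ (F.filter fun e => e.2 ∈ KT).card := by
      refine Finset.mul_card_image_le_card_of_maps_to (f := Prod.snd)
        (fun e he => (Finset.mem_filter.1 he).2) _ fun s hs => ?_
      have h := (Finset.mem_filter.1 hs).2
      refine (Nat.succ_le_of_lt h).trans (Finset.card_le_card fun e he => ?_)
      simp only [Finset.mem_filter, Finset.mem_product, Finset.mem_singleton] at he ⊢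
      obtain ⟨⟨-, rfl⟩, heF⟩ := he
      exact ⟨⟨heF, hs⟩, rfl⟩
    have hKTF : (F.filter fun e => e.2 ∈ KT).card ≤ F.card := Finset.card_filter_le _ _
    have hcard : (KG.disjSum KT).card = KG.card + KT.card := Finset.card_disjSum _ _
    obtain ⟨y, hy0, hyF, hyrow, hyK⟩ := exists_direction_of_rows F hF
      (fun e he => hx.exists_ne_frac_row he) (KG.disjSum KT) W (by
        rw [hcard]
        nlinarith) (by
        intro heq y hyF hyK
        rw [hcard] at heq
        have hcov : F.card ≤ (F.filter fun e => e.2 ∈ KT).card := by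
          nlinarith
        have hFeq := Finset.eq_of_subset_of_card_le (Finset.filter_subset _ _) hcov
        have hmaps : ∀ e ∈ F, e.2 ∈ KT := Finset.filter_eq_self.1 hFeq
        rw [← Finset.sum_fiberwise_of_maps_to hmaps]
        refine Finset.sum_eq_zero fun s hs => ?_
        rw [← sum_column_eq_sum_filter hyF]
        exact hyK (Sum.inr s) (by simpa using hs))
    refine ⟨y, hy0, hyF, ?_, ?_⟩
    · intro A hA _
      obtain ⟨p, -, rfl⟩ := Finset.mem_image.1 hA
      rw [sum_row_eq_sum_filter hyF]
      exact hyrow p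
    · rintro A n (⟨s, hs, i, rfl, rfl⟩ | ⟨s, hs, rfl, rfl⟩) hn
      · refine hyK (Sum.inl (s, i)) ?_
        rw [Finset.inl_mem_disjSum]
        exact Finset.mem_filter.2 ⟨by simpa using hs, hn⟩
      · refine hyK (Sum.inr s) ?_
        rw [Finset.inr_mem_disjSum]
        exact Finset.mem_filter.2 ⟨hs, hn⟩)
  refine ⟨ψ, hx₀.of_floor_ceil (fun e he => ?_) fun p hp => h2 _ (hrowU p hp), h1, ?_, ?_, h4⟩
  · rcases h1 e he with h | h <;> simp [h]
  · intro s hs i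
    exact_mod_cast h3 _ _ (Or.inl ⟨s, hs, i, rfl, rfl⟩)
  · intro s hs
    exact_mod_cast h3 _ _ (Or.inr ⟨s, hs, rfl, rfl⟩)

/-- Rounding for disjoint groups, the fibers of `g`. Here all group sums and column sums stay
between the floor and the ceiling of their initial values. Once integral they are to be kept; the
equations are made disjoint by replacing the sum of a column by the sum over those of its groups
whose own sum is not integral. An equation with a fractional variable then has two of them, which
gives at most one equation for two variables. -/
theorem exists_integral_assignment_of_disjoint {α β ι : Type*} [Fintype ι] {P : Finset α}
    {S : Finset β} (G : ι → Finset α) (hG : ∀ i, G i ⊆ P) (g : α → ι)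
    (hg : ∀ p ∈ P, ∀ i, p ∈ G i ↔ g p = i) {x₀ : α × β → ℝ}
    (hx₀ : IsPairAssignment P S x₀) (w : α × β → ℝ) :
    ∃ ψ : α × β → ℝ, IsPairAssignment P S ψ ∧ (∀ e ∈ P ×ˢ S, ψ e = 0 ∨ ψ e = 1) ∧
      (∀ s ∈ S, ∀ i, |∑ e ∈ G i ×ˢ {s}, ψ e - ∑ e ∈ G i ×ˢ {s}, x₀ e| ≤ 1) ∧
      (∀ s ∈ S, |∑ e ∈ P ×ˢ {s}, ψ e - ∑ e ∈ P ×ˢ {s}, x₀ e| ≤ 1) ∧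
      ∑ e ∈ P ×ˢ S, w e * ψ e ≤ ∑ e ∈ P ×ˢ S, w e * x₀ e := by
  classical
  let UR : Finset (Finset (α × β)) := P.image fun p => {p} ×ˢ S
  let UG : Finset (Finset (α × β)) := (Finset.univ ×ˢ S).image fun k => G k.1 ×ˢ {k.2}
  let UT : Finset (Finset (α × β)) := S.image fun s => P ×ˢ {s}
  let U := UR ∪ UG ∪ UT
  have hrowU : ∀ p ∈ P, {p} ×ˢ S ∈ U := fun p hp =>
    Finset.mem_union_left _ (Finset.mem_union_left _
      (Finset.mem_image_of_mem (fun p => ({p} : Finset α) ×ˢ S) hp))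
  have hgroupU : ∀ i, ∀ s ∈ S, G i ×ˢ {s} ∈ U := fun i s hs =>
    Finset.mem_union_left _ (Finset.mem_union_right _
      (Finset.mem_image.2 ⟨(i, s), by simpa using hs, rfl⟩))
  have hcolU : ∀ s ∈ S, P ×ˢ {s} ∈ U := fun s hs =>
    Finset.mem_union_right _ (Finset.mem_image.2 ⟨s, hs, rfl⟩)
  obtain ⟨ψ, h1, h2, -, h4⟩ := exists_integral_rounding (P ×ˢ S) U (fun _ _ => False) x₀ w
    (fun _ _ h => h.elim) hx₀.mem_unit (by
    intro x hx01 hxU hF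
    have hx : IsPairAssignment P S x :=
      hx₀.of_floor_ceil hx01 fun p hp => hxU _ (hrowU p hp)
    set F := fracSupport (P ×ˢ S) x with hFdef
    have hFD : ∀ e ∈ F, e.1 ∈ P ∧ e.2 ∈ S := fun e he =>
      Finset.mem_product.1 (mem_fracSupport.1 he).1
    let tightG : ι × β → Prop := fun k => ∃ z : ℤ, ∑ e ∈ G k.1 ×ˢ {k.2}, x e = z
    let tightT : β → Prop := fun s => ∃ z : ℤ, ∑ e ∈ P ×ˢ {s}, x e = z
    -- The equation in which a variable takes part, if any.
    let col : α × β → Option ((ι × β) ⊕ β) := fun e =>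
      if tightG (g e.1, e.2) then some (Sum.inl (g e.1, e.2))
      else if tightT e.2 then some (Sum.inr e.2) else none
    have hcolG : ∀ e k, col e = some (Sum.inl k) ↔ tightG k ∧ (g e.1, e.2) = k := by
      intro e k
      simp only [col]
      split_ifs with h h'
      · simp only [Option.some.injEq, Sum.inl.injEq]
        exact ⟨fun hk => ⟨hk ▸ h, hk⟩, fun hk => hk.2⟩
      · simp only [Option.some.injEq, reduceCtorEq, false_iff]
        exact fun hk => h (hk.2 ▸ hk.1)
      · simp only [false_iff]
        exact fun hk => h (hk.2 ▸ hk.1)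
    have hcolT : ∀ e s, col e = some (Sum.inr s) ↔
        ¬ tightG (g e.1, e.2) ∧ tightT s ∧ e.2 = s := by
      intro e s
      simp only [col]
      split_ifs with h h'
      · simp [h]
      · simp only [Option.some.injEq, Sum.inr.injEq, h, not_false_eq_true, true_and]
        exact ⟨fun hk => ⟨hk ▸ h', hk⟩, fun hk => hk.2⟩
      · simp only [h, not_false_eq_true, true_and, false_iff]
        exact fun hk => h' (hk.2 ▸ hk.1)
    let W : (ι × β) ⊕ β → Finset (α × β) := fun k => F.filter fun e => col e = some k
    let K : Finset ((ι × β) ⊕ β) := (F.image col).eraseNone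
    have hK : ∀ k, k ∈ K ↔ ∃ e ∈ F, col e = some k := by
      intro k
      simp [K]
    have htwo : ∀ e ∈ F, ∀ k, col e = some k → ∃ e' ∈ F, col e' = some k ∧ e' ≠ e := by
      rintro e he (k | s) hk
      · have hk' := (hcolG e k).1 hk
        obtain ⟨ht, rfl⟩ := hk'
        obtain ⟨e', he'A, he'F, hne⟩ := exists_ne_frac_of_sum_integer
          (A := G (g e.1) ×ˢ {e.2})
          (Finset.product_subset_product (hG _) (by simpa using (hFD e he).2)) hx01 ht
          (by simp [hg e.1 (hFD e he).1]) he
        simp only [Finset.mem_product, Finset.mem_singleton] at he'A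
        refine ⟨e', he'F, (hcolG e' _).2 ⟨ht, ?_⟩, hne⟩
        rw [he'A.2, (hg e'.1 (hFD e' he'F).1 _).1 he'A.1]
      · obtain ⟨hnt, hT, rfl⟩ := (hcolT e s).1 hk
        have hint : ∃ z : ℤ,
            ∑ e' ∈ (P ×ˢ {e.2}).filter (fun e' => ¬ tightG (g e'.1, e'.2)), x e' = z := by
          obtain ⟨z, hz⟩ := hT
          have htight : ∃ z' : ℤ,
              ∑ e' ∈ (P ×ˢ {e.2}).filter (fun e' => tightG (g e'.1, e'.2)), x e' = z' := by
            have hm : ∀ e' ∈ (P ×ˢ {e.2}).filter (fun e' => tightG (g e'.1, e'.2)),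
                g e'.1 ∈ Finset.univ.filter fun i => tightG (i, e.2) := by
              intro e' he'
              simp only [Finset.mem_filter, Finset.mem_product, Finset.mem_singleton] at he'
              simpa [← he'.1.2] using he'.2
            rw [← Finset.sum_fiberwise_of_maps_to hm]
            have hz : ∀ i ∈ Finset.univ.filter (fun i => tightG (i, e.2)), ∃ z : ℤ,
                ∑ e' ∈ ((P ×ˢ {e.2}).filter (fun e' => tightG (g e'.1, e'.2))).filter
                  (fun e' => g e'.1 = i), x e' = z := by
              intro i hi
              have hi' : tightG (i, e.2) := (Finset.mem_filter.1 hi).2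
              obtain ⟨z, hz⟩ := hi'
              refine ⟨z, ?_⟩
              rw [← hz]
              refine Finset.sum_congr ?_ fun _ _ => rfl
              ext e'
              simp only [Finset.mem_filter, Finset.mem_product, Finset.mem_singleton]
              constructor
              · rintro ⟨⟨⟨hp, hs⟩, -⟩, rfl⟩
                exact ⟨(hg e'.1 hp _).2 rfl, hs⟩
              · rintro ⟨hp, hs⟩
                have hpi := (hg e'.1 (hG i hp) i).1 hp
                exact ⟨⟨⟨hG i hp, hs⟩, by rw [hpi, hs]; exact (Finset.mem_filter.1 hi).2⟩, hpi⟩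
            choose! c hc using hz
            exact ⟨∑ i ∈ Finset.univ.filter (fun i => tightG (i, e.2)), c i, by
              rw [Finset.sum_congr rfl hc]; push_cast; rfl⟩
          obtain ⟨z', hz'⟩ := htight
          refine ⟨z - z', ?_⟩
          have := Finset.sum_filter_add_sum_filter_not (P ×ˢ {e.2})
            (fun e' => tightG (g e'.1, e'.2)) x
          push_cast
          linarith
        obtain ⟨e', he'A, he'F, hne⟩ := exists_ne_frac_of_sum_integer
          ((Finset.filter_subset _ _).trans
            (Finset.product_subset_product_right (by simpa using (hFD e he).2))) hx01 hint
          (by simp [hnt, (hFD e he).1]) he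
        simp only [Finset.mem_filter, Finset.mem_product, Finset.mem_singleton] at he'A
        exact ⟨e', he'F, (hcolT e' _).2 ⟨he'A.2, hT, he'A.1.2⟩, hne⟩
    have hcard : 2 * K.card ≤ (F.filter fun e => (col e).isSome).card := by
      have himg : (K.map Function.Embedding.some).card = K.card := Finset.card_map _
      rw [← himg]
      refine Finset.mul_card_image_le_card_of_maps_to (f := col) ?_ _ ?_
      · intro e he
        obtain ⟨heF, hs⟩ := Finset.mem_filter.1 he
        obtain ⟨k, hk⟩ := Option.isSome_iff_exists.1 hs
        rw [hk]
        exact Finset.mem_map_of_mem Function.Embedding.some ((hK k).2 ⟨e, heF, hk⟩)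
      · intro o ho
        obtain ⟨k, hk, rfl⟩ := Finset.mem_map.1 ho
        obtain ⟨e, heF, hek⟩ := (hK k).1 hk
        obtain ⟨e', he'F, he'k, hne⟩ := htwo e heF k hek
        rw [Nat.succ_le_iff, Finset.one_lt_card]
        exact ⟨e, by simp [heF, hek], e', by simp [he'F, he'k], hne.symm⟩
    have hcardF : (F.filter fun e => (col e).isSome).card ≤ F.card := Finset.card_filter_le _ _
    -- A sum over variables that all take part in equations vanishes if it contains each of these
    -- equations entirely or not at all.
    have hsum0 : ∀ (y : α × β → ℝ), (∀ k ∈ K, ∑ e ∈ W k, y e = 0) → ∀ A ⊆ F,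
        (∀ e ∈ A, ∃ k, col e = some k ∧ W k ⊆ A) → ∑ e ∈ A, y e = 0 := by
      intro y hy A hAF hA
      rw [← Finset.sum_fiberwise_of_maps_to (g := col) (t := A.image col)
        (fun e he => Finset.mem_image_of_mem _ he)]
      refine Finset.sum_eq_zero fun o ho => ?_
      obtain ⟨e, he, rfl⟩ := Finset.mem_image.1 ho
      obtain ⟨k, hk, hWA⟩ := hA e he
      have hWk : A.filter (fun e' => col e' = col e) = W k := by
        ext e'
        simp only [W, Finset.mem_filter, hk]
        refine ⟨fun h => ⟨hAF h.1, h.2⟩, fun h => ⟨hWA ?_, h.2⟩⟩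
        exact Finset.mem_filter.2 h
      rw [hWk]
      exact hy k ((hK k).2 ⟨e, hAF he, hk⟩)
    obtain ⟨y, hy0, hyF, hyrow, hyK⟩ := exists_direction_of_rows F hF
      (fun e he => hx.exists_ne_frac_row he) K W (hcard.trans hcardF) (by
        intro heq y hyF hyK
        have hFeq := Finset.eq_of_subset_of_card_le
          (Finset.filter_subset (fun e => (col e).isSome) F) (by omega)
        have hsome : ∀ e ∈ F, (col e).isSome := Finset.filter_eq_self.1 hFeq
        refine hsum0 y hyK F subset_rfl fun e he => ?_
        obtain ⟨k, hk⟩ := Option.isSome_iff_exists.1 (hsome e he)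
        exact ⟨k, hk, Finset.filter_subset _ _⟩)
    refine ⟨y, hy0, hyF, ?_, fun _ _ h => h.elim⟩
    intro A hA hz
    rcases Finset.mem_union.1 hA with hA | hA
    · rcases Finset.mem_union.1 hA with hA | hA
      · obtain ⟨p, -, rfl⟩ := Finset.mem_image.1 hA
        rw [sum_row_eq_sum_filter hyF]
        exact hyrow p
      · obtain ⟨k, -, rfl⟩ := Finset.mem_image.1 hA
        rw [sum_eq_sum_filter_mem hyF]
        refine hsum0 y hyK _ (Finset.filter_subset _ _) fun e he => ?_
        obtain ⟨heF, heA⟩ := Finset.mem_filter.1 he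
        simp only [Finset.mem_product, Finset.mem_singleton] at heA
        refine ⟨Sum.inl k, (hcolG e k).2 ⟨hz, ?_⟩, fun e' he' => ?_⟩
        · rw [heA.2, (hg e.1 (hFD e heF).1 _).1 heA.1]
        · obtain ⟨he'F, he'k⟩ := Finset.mem_filter.1 he'
          obtain ⟨-, rfl⟩ := (hcolG e' k).1 he'k
          exact Finset.mem_filter.2 ⟨he'F, Finset.mem_product.2
            ⟨(hg e'.1 (hFD e' he'F).1 _).2 rfl, Finset.mem_singleton_self _⟩⟩
    · obtain ⟨s, hs, rfl⟩ := Finset.mem_image.1 hA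
      rw [sum_column_eq_sum_filter hyF]
      refine hsum0 y hyK _ (Finset.filter_subset _ _) fun e he => ?_
      obtain ⟨heF, rfl⟩ := Finset.mem_filter.1 he
      by_cases ht : tightG (g e.1, e.2)
      · refine ⟨_, (hcolG e _).2 ⟨ht, rfl⟩, fun e' he' => ?_⟩
        obtain ⟨he'F, he'k⟩ := Finset.mem_filter.1 he'
        have h := ((hcolG e' _).1 he'k).2
        exact Finset.mem_filter.2 ⟨he'F, (Prod.mk.inj h).2⟩
      · refine ⟨_, (hcolT e _).2 ⟨ht, hz, rfl⟩, fun e' he' => ?_⟩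
        obtain ⟨he'F, he'k⟩ := Finset.mem_filter.1 he'
        exact Finset.mem_filter.2 ⟨he'F, ((hcolT e' _).1 he'k).2.2⟩)
  have habs : ∀ A ∈ U, |∑ e ∈ A, ψ e - ∑ e ∈ A, x₀ e| ≤ 1 := by
    intro A hA
    have h := h2 A hA
    rw [abs_le]
    constructor <;>
      linarith [Int.ceil_lt_add_one (∑ e ∈ A, x₀ e), Int.lt_floor_add_one (∑ e ∈ A, x₀ e)]
  refine ⟨ψ, hx₀.of_floor_ceil (fun e he => ?_) fun p hp => h2 _ (hrowU p hp), h1,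
    fun s hs i => habs _ (hgroupU i s hs), fun s hs => habs _ (hcolU s hs), h4⟩
  rcases h1 e he with h | h <;> simp [h]

/-! ### Small approximate centroid sets -/

/-- Every entry of a vector being small makes the vector small. -/
lemma norm_sq_le_of_forall_abs_le {d : ℕ} (v : Pt d) {r : ℝ} (h : ∀ i, |v i| ≤ r) :
    ‖v‖ ^ 2 ≤ d * r ^ 2 := by
  rw [EuclideanSpace.norm_sq_eq]
  calc ∑ i, ‖v i‖ ^ 2 ≤ ∑ _i : Fin d, r ^ 2 := by
        refine Finset.sum_le_sum fun i _ => ?_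
        rw [Real.norm_eq_abs]
        exact pow_le_pow_left₀ (abs_nonneg _) (h i) 2
    _ = d * r ^ 2 := by simp

lemma norm_sub_centroidOf_le {d : ℕ} {Q : Finset (Pt d)} (hQ : Q.Nonempty) (p : Pt d) {D : ℝ}
    (h : ∀ q ∈ Q, ‖q - p‖ ≤ D) : ‖centroidOf Q - p‖ ≤ D := by
  have hc : (0 : ℝ) < Q.card := by exact_mod_cast hQ.card_pos
  have heq : centroidOf Q - p = (Q.card : ℝ)⁻¹ • ∑ q ∈ Q, (q - p) := by
    rw [Finset.sum_sub_distrib, Finset.sum_const, smul_sub, ← Nat.cast_smul_eq_nsmul ℝ,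
      smul_smul, inv_mul_cancel₀ hc.ne', one_smul]
    rfl
  rw [heq, norm_smul, norm_inv, Real.norm_of_nonneg hc.le, inv_mul_le_iff₀ hc]
  calc ‖∑ q ∈ Q, (q - p)‖ ≤ ∑ q ∈ Q, ‖q - p‖ := norm_sum_le _ _
    _ ≤ ∑ q ∈ Q, D := Finset.sum_le_sum h
    _ = Q.card * D := by simp

/-- Two points at distance `D` force a variance of order `D²`. -/
lemma sq_dist_le_two_mul_sum {d : ℕ} {Q : Finset (Pt d)} {p q : Pt d} (hp : p ∈ Q) (hq : q ∈ Q)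
    (c : Pt d) : ‖q - p‖ ^ 2 ≤ 2 * ∑ x ∈ Q, ‖x - c‖ ^ 2 := by
  classical
  by_cases hpq : q = p
  · subst hpq
    simpa using Finset.sum_nonneg fun x _ => sq_nonneg ‖x - c‖
  have hsub : ({q, p} : Finset (Pt d)) ⊆ Q := by
    intro x hx
    rcases Finset.mem_insert.1 hx with rfl | hx
    · exact hq
    · exact Finset.mem_singleton.1 hx ▸ hp
  have h1 : ‖q - c‖ ^ 2 + ‖p - c‖ ^ 2 ≤ ∑ x ∈ Q, ‖x - c‖ ^ 2 := by
    rw [← Finset.sum_pair hpq (f := fun x => ‖x - c‖ ^ 2)]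
    exact Finset.sum_le_sum_of_subset_of_nonneg hsub fun _ _ _ => sq_nonneg _
  have h2 : ‖q - p‖ ≤ ‖q - c‖ + ‖p - c‖ := by
    have := norm_sub_le (q - c) (p - c)
    rwa [sub_sub_sub_cancel_right] at this
  have h3 : ‖q - p‖ ^ 2 ≤ (‖q - c‖ + ‖p - c‖) ^ 2 := pow_le_pow_left₀ (norm_nonneg _) h2 2
  nlinarith [sq_nonneg (‖q - c‖ - ‖p - c‖)]

/-- The point with integral coordinates `z` of the grid with origin `p` and width `‖q - p‖ / N`. -/
noncomputable def gridPoint {d : ℕ} (N : ℕ) (p q : Pt d) (z : Fin d → ℤ) : Pt d :=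
  p + (‖q - p‖ / N) • WithLp.toLp 2 fun i => (z i : ℝ)

lemma exists_gridPoint_near {d : ℕ} {N : ℕ} (hN : 0 < N) (p q c : Pt d)
    (hc : ‖c - p‖ ≤ ‖q - p‖) :
    ∃ z ∈ Fintype.piFinset fun _ : Fin d => Finset.Icc (-(N : ℤ)) N,
      ‖gridPoint N p q z - c‖ ^ 2 ≤ d * (‖q - p‖ / N) ^ 2 := by
  have hN' : (0 : ℝ) < N := by exact_mod_cast hN
  set D := ‖q - p‖ with hD
  have hcoord : ∀ i, |c i - p i| ≤ D := by
    intro i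
    have := PiLp.norm_apply_le (c - p) i
    rw [Real.norm_eq_abs] at this
    exact (by simpa using this : |c i - p i| ≤ ‖c - p‖).trans hc
  have hD0 : 0 ≤ D := norm_nonneg _
  rcases hD0.eq_or_lt with h0 | hpos
  · refine ⟨0, by simp, ?_⟩
    have hcp : c = p := by
      rw [← sub_eq_zero, ← norm_le_zero_iff]
      exact hc.trans h0.symm.le
    simp [gridPoint, ← hD, ← h0, hcp]
  · refine ⟨fun i => ⌊(c i - p i) / (D / N)⌋, ?_, ?_⟩
    · rw [Fintype.mem_piFinset]
      intro i
      have hw : 0 < D / N := by positivity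
      have habs : |(c i - p i) / (D / N)| ≤ N := by
        rw [abs_div, abs_of_pos hw, div_le_iff₀ hw]
        calc |c i - p i| ≤ D := hcoord i
          _ = N * (D / N) := by field_simp
      obtain ⟨h1, h2⟩ := abs_le.1 habs
      rw [Finset.mem_Icc]
      constructor
      · exact Int.le_floor.2 (by push_cast; exact h1)
      · exact Int.cast_le.1 ((Int.floor_le _).trans (h2.trans (by simp)) : _ ≤ (((N : ℤ) : ℝ)))
    · refine norm_sq_le_of_forall_abs_le _ fun i => ?_
      have hw : 0 < D / N := by positivity
      set u := (c i - p i) / (D / N) with hu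
      have hcu : c i = p i + D / N * u := by
        rw [hu]
        field_simp
        ring
      have heq : (gridPoint N p q (fun i => ⌊(c i - p i) / (D / N)⌋) - c) i
          = D / N * (⌊u⌋ - u) := by
        simp only [gridPoint, PiLp.sub_apply, PiLp.add_apply, PiLp.smul_apply, smul_eq_mul,
          ← hD, ← hu]
        rw [hcu]
        ring
      rw [heq, abs_mul, abs_of_pos hw]
      have h1 := Int.floor_le u
      have h2 := Int.lt_floor_add_one u
      have : |(⌊u⌋ : ℝ) - u| ≤ 1 := by
        rw [abs_le]
        constructor <;> linarith
      nlinarith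

open Classical in
/-- The union of the grids with `(2N+1)^d` points around each point of `P` whose radius is the
distance to some point of `P`. -/
noncomputable def gridSet {d : ℕ} (P : Finset (Pt d)) (N : ℕ) : Finset (Pt d) :=
  (P ×ˢ P ×ˢ Fintype.piFinset fun _ : Fin d => Finset.Icc (-(N : ℤ)) N).image
    fun k => gridPoint N k.1 k.2.1 k.2.2

lemma card_gridSet_le {d : ℕ} (P : Finset (Pt d)) (N : ℕ) :
    ((gridSet P N).card : ℝ) ≤ P.card * (P.card * (2 * N + 1) ^ d) := by
  classical
  have hZ : (Fintype.piFinset fun _ : Fin d => Finset.Icc (-(N : ℤ)) N).card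
      = (2 * N + 1) ^ d := by
    rw [Fintype.card_piFinset]
    simp only [Int.card_Icc, Finset.prod_const, Finset.card_univ, Fintype.card_fin]
    congr 1
    omega
  have : (gridSet P N).card ≤ P.card * (P.card * (2 * N + 1) ^ d) := by
    refine Finset.card_image_le.trans ?_
    rw [Finset.card_product, Finset.card_product, hZ]
  exact_mod_cast this

lemma grid_error_bound {d n c N ε X D : ℝ} (hd : 0 ≤ d) (hc : 0 < c) (hcn : c ≤ n) (hn : 1 ≤ n)
    (hN : 0 < N) (hX : 0 ≤ X) (hεN : 6 * (d + 1) * n ≤ ε * N) (hD : D ^ 2 ≤ 2 * X) :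
    d * (D / N) ^ 2 ≤ (ε / 3) ^ 2 * (c⁻¹ * X) := by
  have hcount : 18 * d * c ≤ (ε * N) ^ 2 := by
    calc 18 * d * c ≤ 36 * (d + 1) ^ 2 * n ^ 2 := by
          have h1 : d ≤ (d + 1) ^ 2 := by nlinarith
          have h2 : c ≤ n ^ 2 := by nlinarith
          gcongr
          norm_num
      _ = (6 * (d + 1) * n) ^ 2 := by ring
      _ ≤ (ε * N) ^ 2 := by gcongr
  calc d * (D / N) ^ 2 = d * D ^ 2 / N ^ 2 := by rw [div_pow]; ring
    _ ≤ d * (2 * X) / N ^ 2 := by gcongr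
    _ = (18 * d * c) * (X / (9 * c * N ^ 2)) := by field_simp; ring
    _ ≤ (ε * N) ^ 2 * (X / (9 * c * N ^ 2)) := by gcongr
    _ = (ε / 3) ^ 2 * (c⁻¹ * X) := by field_simp; ring

/-- For `Q ⊆ P`, the grid around a point of `Q` whose radius is the distance to another point of
`Q`, the two being as far apart as possible, contains a point close to the centroid. -/
lemma isApproxCentroidSet_gridSet {d : ℕ} (P : Finset (Pt d)) {ε : ℝ} (hε : 0 < ε) {N : ℕ}
    (hN : 0 < N) (hεN : 6 * (d + 1) * (P.card : ℝ) ≤ ε * N) :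
    IsApproxCentroidSet ε P (gridSet P N) := by
  classical
  intro Q hQP hQ
  obtain ⟨⟨p, q⟩, hpq, hmax⟩ := Finset.exists_max_image (Q ×ˢ Q) (fun k => ‖k.2 - k.1‖)
    (hQ.product hQ)
  obtain ⟨hp, hq⟩ := Finset.mem_product.1 hpq
  simp only at hp hq hmax
  have hcent : ‖centroidOf Q - p‖ ≤ ‖q - p‖ :=
    norm_sub_centroidOf_le hQ p fun x hx => hmax (p, x) (Finset.mem_product.2 ⟨hp, hx⟩)
  obtain ⟨z, hz, hzc⟩ := exists_gridPoint_near hN p q (centroidOf Q) hcent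
  refine ⟨gridPoint N p q z, Finset.mem_image.2
    ⟨(p, q, z), Finset.mem_product.2 ⟨hQP hp, Finset.mem_product.2 ⟨hQP hq, hz⟩⟩, rfl⟩, ?_⟩
  have hX0 : 0 ≤ ∑ x ∈ Q, ‖x - centroidOf Q‖ ^ 2 := Finset.sum_nonneg fun _ _ => sq_nonneg _
  have hQ0 : (0 : ℝ) < Q.card := by exact_mod_cast hQ.card_pos
  have hQn : (Q.card : ℝ) ≤ P.card := by exact_mod_cast Finset.card_le_card hQP
  have hn1 : (1 : ℝ) ≤ P.card := by exact_mod_cast (hQ.mono hQP).card_pos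
  have hsq : ‖gridPoint N p q z - centroidOf Q‖ ^ 2
      ≤ (ε / 3 * Real.sqrt ((Q.card : ℝ)⁻¹ * ∑ x ∈ Q, ‖x - centroidOf Q‖ ^ 2)) ^ 2 := by
    rw [mul_pow, Real.sq_sqrt (mul_nonneg (inv_nonneg.2 hQ0.le) hX0)]
    exact hzc.trans (grid_error_bound (Nat.cast_nonneg d) hQ0 hQn hn1 (by exact_mod_cast hN) hX0
      hεN (sq_dist_le_two_mul_sum hp hq _))
  exact (le_abs_self _).trans (abs_le_of_sq_le_sq hsq
    (mul_nonneg (by linarith) (Real.sqrt_nonneg _)))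

theorem exists_small_approxCentroidSet {d : ℕ} (P : Finset (Pt d)) (hP : P.Nonempty) {ε : ℝ}
    (hε : 0 < ε) (hε1 : ε ≤ 1) :
    ∃ T, IsApproxCentroidSet ε P T ∧
      (T.card : ℝ) ≤ ((18 * d + 21 : ℕ) * (P.card : ℝ) / ε) ^ (18 * d + 21) := by
  have hn1 : (1 : ℝ) ≤ P.card := by exact_mod_cast hP.card_pos
  have hd0 : (0 : ℝ) ≤ d := Nat.cast_nonneg d
  have hB : ((18 * d + 21 : ℕ) : ℝ) * (P.card : ℝ) / ε
      = (18 * d + 21) * ((P.card : ℝ) / ε) := by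
    push_cast
    ring
  rw [hB]
  have hεb : ε * ((P.card : ℝ) / ε) = P.card := by field_simp
  have hnb' : (P.card : ℝ) ≤ P.card / ε := by
    rw [le_div_iff₀ hε]
    nlinarith
  generalize (P.card : ℝ) / ε = b at *
  have hb1 : 1 ≤ b := hn1.trans hnb'
  obtain ⟨N, hNge, hNlt⟩ : ∃ N : ℕ, 6 * (d + 1) * b ≤ N ∧ (N : ℝ) < 6 * (d + 1) * b + 1 :=
    ⟨_, Nat.le_ceil _, Nat.ceil_lt_add_one (by positivity)⟩
  have hN1 : (1 : ℝ) ≤ N := by nlinarith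
  refine ⟨gridSet P N, isApproxCentroidSet_gridSet P hε
    (by exact_mod_cast zero_lt_one.trans_le hN1) ?_, ?_⟩
  · calc 6 * (d + 1) * (P.card : ℝ) = ε * (6 * (d + 1) * b) := by rw [← hεb]; ring
      _ ≤ ε * N := by gcongr
  · have hnb : (P.card : ℝ) ≤ (18 * d + 21) * b := by nlinarith
    have hNb : 2 * (N : ℝ) + 1 ≤ (18 * d + 21) * b := by nlinarith
    have hB1 : 1 ≤ (18 * d + 21) * b := hn1.trans hnb
    calc ((gridSet P N).card : ℝ) ≤ P.card * (P.card * (2 * N + 1) ^ d) := card_gridSet_le P N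
      _ ≤ ((18 * d + 21) * b) * (((18 * d + 21) * b) * ((18 * d + 21) * b) ^ d) := by gcongr
      _ = ((18 * d + 21) * b) ^ (d + 2) := by ring
      _ ≤ ((18 * d + 21) * b) ^ (18 * d + 21) := pow_le_pow_right₀ hB1 (by omega)

/-! ### Clusters and their centroids -/

/-- The decomposition of a weighted sum of squared distances to `z` into the part to the centroid
and the distance of the centroid to `z`. -/
lemma sum_sq_dist_mul_eq {d : ℕ} (P : Finset (Pt d)) (f : Pt d → ℝ) (hf : ∑ p ∈ P, f p ≠ 0)
    (z : Pt d) :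
    ∑ p ∈ P, ‖p - z‖ ^ 2 * f p =
      ∑ p ∈ P, ‖p - (∑ p ∈ P, f p)⁻¹ • ∑ p ∈ P, f p • p‖ ^ 2 * f p +
        (∑ p ∈ P, f p) * ‖(∑ p ∈ P, f p)⁻¹ • ∑ p ∈ P, f p • p - z‖ ^ 2 := by
  set w := ∑ p ∈ P, f p with hw
  set c := w⁻¹ • ∑ p ∈ P, f p • p with hc
  have hcross : ∑ p ∈ P, f p * inner ℝ (p - c) (c - z) = 0 := by
    have : ∑ p ∈ P, f p • (p - c) = 0 := by
      simp only [smul_sub, Finset.sum_sub_distrib]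
      rw [← Finset.sum_smul, ← hw, hc, smul_smul, mul_inv_cancel₀ hf, one_smul, sub_self]
    calc ∑ p ∈ P, f p * inner ℝ (p - c) (c - z)
        = inner ℝ (∑ p ∈ P, f p • (p - c)) (c - z) := by
          rw [sum_inner]
          exact Finset.sum_congr rfl fun p _ => by rw [real_inner_smul_left]
      _ = 0 := by rw [this, inner_zero_left]
  have hterm : ∀ p, ‖p - z‖ ^ 2 * f p =
      ‖p - c‖ ^ 2 * f p + 2 * (f p * inner ℝ (p - c) (c - z)) + f p * ‖c - z‖ ^ 2 := by
    intro p
    have : p - z = (p - c) + (c - z) := by abel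
    rw [this, norm_add_sq_real]
    ring
  simp only [hterm, Finset.sum_add_distrib]
  rw [← Finset.mul_sum, hcross, ← Finset.sum_mul, ← hw]
  ring

namespace FairInstance

variable {d m : ℕ}

lemma group_subset (I : FairInstance d m) (i : Fin m) : I.groups i ⊆ I.points :=
  fun p hp => (I.mem_points_iff p).2 ⟨i, hp⟩

/-- If `t` receives no weight, its junk value `adjust φ t = 0` does not matter. -/
lemma sum_sq_dist_eq_adjust (I : FairInstance d m) {φ : Pt d → Pt d → ℝ} {t : Pt d}
    (hφ : ∀ p ∈ I.points, 0 ≤ φ p t) (z : Pt d) :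
    ∑ p ∈ I.points, ‖p - z‖ ^ 2 * φ p t =
      ∑ p ∈ I.points, ‖p - I.adjust φ t‖ ^ 2 * φ p t +
        weightOn I.points φ t * ‖I.adjust φ t - z‖ ^ 2 := by
  by_cases hw : weightOn I.points φ t = 0
  · have h0 : ∀ p ∈ I.points, φ p t = 0 := (Finset.sum_eq_zero_iff_of_nonneg hφ).1 hw
    rw [hw, zero_mul, add_zero]
    exact Finset.sum_congr rfl fun p hp => by rw [h0 p hp, mul_zero, mul_zero]
  · exact sum_sq_dist_mul_eq I.points (fun p => φ p t) hw z

lemma IsIntegralAssignment.sum_smul_eq (I : FairInstance d m) {S : Finset (Pt d)}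
    {φ : Pt d → Pt d → ℝ} (hφ : I.IsIntegralAssignment S φ) {s : Pt d} (hs : s ∈ S)
    {M : Type*} [AddCommGroup M] [Module ℝ M] [DecidablePred fun p => φ p s = 1] (f : Pt d → M) :
    ∑ p ∈ I.points, φ p s • f p = ∑ p ∈ I.points.filter (fun p => φ p s = 1), f p := by
  rw [Finset.sum_filter]
  refine Finset.sum_congr rfl fun p hp => ?_
  rcases hφ.2 p hp s hs with h | h <;> simp [h]

/-! ### Redirecting the centers of an assignment -/

open Classical in
/-- The assignment that sends to `τ s` whatever `φ` sends to `s`. -/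
noncomputable def reassign (S : Finset (Pt d)) (φ : Pt d → Pt d → ℝ) (τ : Pt d → Pt d) :
    Pt d → Pt d → ℝ :=
  fun p t => ∑ s ∈ S.filter (fun s => τ s = t), φ p s

open Classical in
lemma weightOn_reassign (A S : Finset (Pt d)) (φ : Pt d → Pt d → ℝ) (τ : Pt d → Pt d)
    (t : Pt d) :
    weightOn A (reassign S φ τ) t = ∑ s ∈ S.filter (fun s => τ s = t), weightOn A φ s :=
  Finset.sum_comm

lemma IsAssignment.reassign {I : FairInstance d m} {S T : Finset (Pt d)} {φ : Pt d → Pt d → ℝ}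
    (hφ : I.IsAssignment S φ) {τ : Pt d → Pt d} (hτ : ∀ s ∈ S, τ s ∈ T) :
    I.IsAssignment T (reassign S φ τ) := by
  classical
  refine ⟨fun p hp t _ => Finset.sum_nonneg fun s hs => ?_, fun p hp => ?_⟩
  · exact hφ.1 p hp s (Finset.mem_filter.1 hs).1
  · rw [← hφ.2 p hp, ← Finset.sum_fiberwise_of_maps_to hτ]
    refine Finset.sum_congr rfl fun t _ => ?_
    simp only [FairInstance.reassign]

/-- The fairness constraints of the centers sent to the same point add up. -/
lemma IsFair.reassign {I : FairInstance d m} {S : Finset (Pt d)} {φ : Pt d → Pt d → ℝ}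
    (hφ : I.IsFair S φ) (T : Finset (Pt d)) (τ : Pt d → Pt d) :
    I.IsFair T (reassign S φ τ) := by
  classical
  intro t _ i
  rw [weightOn_reassign, weightOn_reassign, Finset.mul_sum, Finset.mul_sum]
  exact ⟨Finset.sum_le_sum fun s hs => (hφ s (Finset.mem_filter.1 hs).1 i).1,
    Finset.sum_le_sum fun s hs => (hφ s (Finset.mem_filter.1 hs).1 i).2⟩

lemma cost_reassign (I : FairInstance d m) {S T : Finset (Pt d)} (φ : Pt d → Pt d → ℝ)
    {τ : Pt d → Pt d} (hτ : ∀ s ∈ S, τ s ∈ T) :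
    I.cost T (reassign S φ τ) = ∑ p ∈ I.points, ∑ s ∈ S, ‖p - τ s‖ ^ 2 * φ p s := by
  classical
  refine Finset.sum_congr rfl fun p _ => ?_
  rw [← Finset.sum_fiberwise_of_maps_to hτ]
  refine Finset.sum_congr rfl fun t _ => ?_
  simp only [reassign]
  rw [Finset.mul_sum]
  refine Finset.sum_congr (by congr) fun s hs => ?_
  rw [(Finset.mem_filter.1 hs).2]

/-! ### The linear program has an optimal solution -/

lemma weightOn_congr {A S : Finset (Pt d)} {P : Finset (Pt d)} (hA : A ⊆ P)
    {φ ψ : Pt d → Pt d → ℝ} (h : ∀ p ∈ P, ∀ s ∈ S, φ p s = ψ p s) {s : Pt d} (hs : s ∈ S) :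
    weightOn A φ s = weightOn A ψ s :=
  Finset.sum_congr rfl fun p hp => h p (hA hp) s hs

lemma IsAssignment.congr {I : FairInstance d m} {S : Finset (Pt d)} {φ ψ : Pt d → Pt d → ℝ}
    (hφ : I.IsAssignment S φ) (h : ∀ p ∈ I.points, ∀ s ∈ S, φ p s = ψ p s) :
    I.IsAssignment S ψ := by
  refine ⟨fun p hp s hs => h p hp s hs ▸ hφ.1 p hp s hs, fun p hp => ?_⟩
  rw [← hφ.2 p hp]
  exact Finset.sum_congr rfl fun s hs => (h p hp s hs).symm

lemma IsFair.congr {I : FairInstance d m} {S : Finset (Pt d)} {φ ψ : Pt d → Pt d → ℝ}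
    (hφ : I.IsFair S φ) (h : ∀ p ∈ I.points, ∀ s ∈ S, φ p s = ψ p s) : I.IsFair S ψ := by
  intro s hs i
  rw [← weightOn_congr subset_rfl h hs, ← weightOn_congr (I.group_subset i) h hs]
  exact hφ s hs i

lemma cost_congr (I : FairInstance d m) {S : Finset (Pt d)} {φ ψ : Pt d → Pt d → ℝ}
    (h : ∀ p ∈ I.points, ∀ s ∈ S, φ p s = ψ p s) : I.cost S φ = I.cost S ψ :=
  Finset.sum_congr rfl fun p hp => Finset.sum_congr rfl fun s hs => by rw [h p hp s hs]

lemma IsAssignment.le_one {I : FairInstance d m} {S : Finset (Pt d)} {φ : Pt d → Pt d → ℝ}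
    (hφ : I.IsAssignment S φ) {p s : Pt d} (hp : p ∈ I.points) (hs : s ∈ S) : φ p s ≤ 1 := by
  rw [← hφ.2 p hp]
  exact Finset.single_le_sum (fun s hs => hφ.1 p hp s hs) hs

lemma continuous_weightOn (A : Finset (Pt d)) (s : Pt d) :
    Continuous fun φ : Pt d → Pt d → ℝ => weightOn A φ s := by
  unfold weightOn
  fun_prop

/-- The fair assignments with all values in the unit interval, also those off `points × S`, form a
compact set in the product topology, and the cost is continuous. -/
lemma exists_isOptimalAssignment {I : FairInstance d m} {S : Finset (Pt d)}
    (h : ∃ φ, I.IsAssignment S φ ∧ I.IsFair S φ) : ∃ φ, I.IsOptimalAssignment S φ := by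
  classical
  let box : Set (Pt d → Pt d → ℝ) :=
    Set.pi Set.univ fun _ => Set.pi Set.univ fun _ => Set.Icc (0 : ℝ) 1
  have hbox : IsCompact box := isCompact_univ_pi fun _ => isCompact_univ_pi fun _ => isCompact_Icc
  let C : Set (Pt d → Pt d → ℝ) := {φ | I.IsAssignment S φ ∧ I.IsFair S φ}
  have hC : IsClosed C := by
    simp only [C, IsAssignment, IsFair, Set.ofPred_and, Set.ofPred_forall]
    refine ((isClosed_iInter fun p => isClosed_iInter fun _ => isClosed_iInter fun s =>
      isClosed_iInter fun _ => isClosed_le (by fun_prop) (by fun_prop)).inter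
      (isClosed_iInter fun p => isClosed_iInter fun _ =>
        isClosed_eq (by fun_prop) (by fun_prop))).inter
      (isClosed_iInter fun s => isClosed_iInter fun _ => isClosed_iInter fun i =>
        (isClosed_le ((continuous_weightOn _ s).const_mul _) (continuous_weightOn _ s)).inter
        (isClosed_le (continuous_weightOn _ s) ((continuous_weightOn _ s).const_mul _)))
  have hcont : Continuous fun φ : Pt d → Pt d → ℝ => I.cost S φ := by
    unfold cost
    fun_prop
  -- Only the values on `points × S` matter, so that one can pass to the box.
  have hnorm : ∀ φ, I.IsAssignment S φ → I.IsFair S φ →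
      ∃ φ' ∈ box ∩ C, I.cost S φ' = I.cost S φ := by
    intro φ h1 h2
    let φ' : Pt d → Pt d → ℝ := fun p s => if p ∈ I.points ∧ s ∈ S then φ p s else 0
    have hφ' : ∀ p ∈ I.points, ∀ s ∈ S, φ p s = φ' p s := by
      intro p hp s hs
      simp [φ', hp, hs]
    refine ⟨φ', ⟨?_, h1.congr hφ', h2.congr hφ'⟩, (I.cost_congr hφ').symm⟩
    intro p _ s _
    by_cases hps : p ∈ I.points ∧ s ∈ S
    · simp only [φ', if_pos hps]
      exact ⟨h1.1 p hps.1 s hps.2, h1.le_one hps.1 hps.2⟩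
    · simp [φ', if_neg hps]
  obtain ⟨φ₀, h1, h2⟩ := h
  obtain ⟨φ₁, hφ₁, -⟩ := hnorm φ₀ h1 h2
  obtain ⟨φ, hφ, hmin⟩ := (hbox.inter_right hC).exists_isMinOn ⟨φ₁, hφ₁⟩ hcont.continuousOn
  refine ⟨φ, hφ.2, fun ψ hψ1 hψ2 => ?_⟩
  obtain ⟨ψ', hψ', heq⟩ := hnorm ψ hψ1 hψ2
  rw [← heq]
  exact isMinOn_iff.1 hmin ψ' hψ'

lemma IsAssignment.nonempty {I : FairInstance d m} {S : Finset (Pt d)} {φ : Pt d → Pt d → ℝ}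
    (hφ : I.IsAssignment S φ) (hP : I.points.Nonempty) : S.Nonempty := by
  obtain ⟨p, hp⟩ := hP
  by_contra h
  have := hφ.2 p hp
  rw [Finset.not_nonempty_iff_eq_empty.1 h, Finset.sum_empty] at this
  exact zero_ne_one this

/-- If the instance is feasible, then assigning everything to a single center is fair. -/
lemma Feasible.exists_isOptimalAssignment {I : FairInstance d m} (h : I.Feasible)
    {T : Finset (Pt d)} (hT : T.Nonempty) : ∃ φ, I.IsOptimalAssignment T φ := by
  obtain ⟨S, φ, -, hφ, hfair⟩ := h
  obtain ⟨t, ht⟩ := hT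
  exact FairInstance.exists_isOptimalAssignment
    ⟨_, hφ.1.reassign (τ := fun _ => t) fun _ _ => ht, hfair.reassign _ _⟩

/-! ### The cost of the relaxed solution -/

lemma cost_eq_sum_centers (I : FairInstance d m) (S : Finset (Pt d)) (φ : Pt d → Pt d → ℝ) :
    I.cost S φ = ∑ s ∈ S, ∑ p ∈ I.points, ‖p - s‖ ^ 2 * φ p s :=
  Finset.sum_comm

/-- Each cluster of an integral solution can be served by a point of `T` near its centroid. -/
lemma IsIntegralAssignment.exists_near_center {I : FairInstance d m} {ε : ℝ}
    {S T : Finset (Pt d)} (hT : IsApproxCentroidSet ε I.points T) (hT0 : T.Nonempty)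
    {φ : Pt d → Pt d → ℝ} (hφ : I.IsIntegralAssignment S φ) {s : Pt d} (hs : s ∈ S) :
    ∃ t ∈ T, ∑ p ∈ I.points, ‖p - t‖ ^ 2 * φ p s ≤
      (1 + ε ^ 2 / 9) * ∑ p ∈ I.points, ‖p - s‖ ^ 2 * φ p s := by
  classical
  set Q := I.points.filter (fun p => φ p s = 1) with hQ
  have hnn : ∀ p ∈ I.points, 0 ≤ φ p s := fun p hp => hφ.1.1 p hp s hs
  have hsum : ∀ f : Pt d → ℝ, ∑ p ∈ I.points, f p * φ p s = ∑ p ∈ Q, f p := by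
    intro f
    rw [← hφ.sum_smul_eq I hs f]
    exact Finset.sum_congr rfl fun p _ => mul_comm _ _
  rcases Q.eq_empty_or_nonempty with hQ0 | hQne
  · obtain ⟨t, ht⟩ := hT0
    refine ⟨t, ht, ?_⟩
    rw [hsum, hsum, hQ0]
    simp
  · obtain ⟨t, ht, htc⟩ := hT Q (Finset.filter_subset _ _) hQne
    refine ⟨t, ht, ?_⟩
    have hw : weightOn I.points φ s = Q.card := by
      have := hsum fun _ => 1
      simpa [weightOn] using this
    have hc : I.adjust φ s = centroidOf Q := by
      rw [adjust, hw, hφ.sum_smul_eq I hs fun p => p]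
      rfl
    have hQ0 : (0 : ℝ) < Q.card := by exact_mod_cast hQne.card_pos
    have hX0 : 0 ≤ ∑ q ∈ Q, ‖q - centroidOf Q‖ ^ 2 := Finset.sum_nonneg fun _ _ => sq_nonneg _
    have hsq : ‖t - centroidOf Q‖ ^ 2 ≤
        (ε / 3) ^ 2 * ((Q.card : ℝ)⁻¹ * ∑ q ∈ Q, ‖q - centroidOf Q‖ ^ 2) := by
      rw [← Real.sq_sqrt (mul_nonneg (inv_nonneg.2 hQ0.le) hX0), ← mul_pow]
      exact pow_le_pow_left₀ (norm_nonneg _) htc 2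
    have hmove : (Q.card : ℝ) * ‖centroidOf Q - t‖ ^ 2 ≤
        ε ^ 2 / 9 * ∑ q ∈ Q, ‖q - centroidOf Q‖ ^ 2 := by
      rw [norm_sub_rev]
      calc (Q.card : ℝ) * ‖t - centroidOf Q‖ ^ 2
          ≤ Q.card * ((ε / 3) ^ 2 * ((Q.card : ℝ)⁻¹ * ∑ q ∈ Q, ‖q - centroidOf Q‖ ^ 2)) := by
            gcongr
        _ = ε ^ 2 / 9 * ∑ q ∈ Q, ‖q - centroidOf Q‖ ^ 2 := by field_simp; ring
    have ht' := I.sum_sq_dist_eq_adjust hnn t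
    have hs' := I.sum_sq_dist_eq_adjust hnn s
    rw [hc, hw, hsum fun p => ‖p - centroidOf Q‖ ^ 2] at ht' hs'
    have hle : ∑ q ∈ Q, ‖q - centroidOf Q‖ ^ 2 ≤ ∑ p ∈ I.points, ‖p - s‖ ^ 2 * φ p s := by
      rw [hs']
      have := mul_nonneg hQ0.le (sq_nonneg ‖centroidOf Q - s‖)
      linarith
    rw [ht']
    calc _ ≤ (1 + ε ^ 2 / 9) * ∑ q ∈ Q, ‖q - centroidOf Q‖ ^ 2 := by linarith
      _ ≤ _ := by gcongr

lemma IsOptimalAssignment.cost_le_of_approxCentroidSet {I : FairInstance d m} {ε : ℝ}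
    {S T : Finset (Pt d)} (hT : IsApproxCentroidSet ε I.points T) (hT0 : T.Nonempty)
    {φT φ : Pt d → Pt d → ℝ} (hφT : I.IsOptimalAssignment T φT) (hφ : I.IsIntegralSolution S φ) :
    I.cost T φT ≤ (1 + ε ^ 2 / 9) * I.cost S φ := by
  have hnear := fun s (hs : s ∈ S) => hφ.2.1.exists_near_center hT hT0 hs
  choose! τ hτT hτ using hnear
  calc I.cost T φT ≤ I.cost T (reassign S φ τ) :=
        hφT.2 _ (hφ.2.1.1.reassign hτT) (hφ.2.2.reassign _ _)
    _ = ∑ s ∈ S, ∑ p ∈ I.points, ‖p - τ s‖ ^ 2 * φ p s := by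
        rw [I.cost_reassign φ hτT, Finset.sum_comm]
    _ ≤ ∑ s ∈ S, (1 + ε ^ 2 / 9) * ∑ p ∈ I.points, ‖p - s‖ ^ 2 * φ p s := Finset.sum_le_sum hτ
    _ = (1 + ε ^ 2 / 9) * I.cost S φ := by rw [← Finset.mul_sum, cost_eq_sum_centers]

/-! ### The weighted instance of the merge step -/

lemma IsAssignment.weightOn_nonneg {I : FairInstance d m} {T : Finset (Pt d)}
    {φ : Pt d → Pt d → ℝ} (hφ : I.IsAssignment T φ) {t : Pt d} (ht : t ∈ T) :
    0 ≤ weightOn I.points φ t :=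
  Finset.sum_nonneg fun p hp => hφ.1 p hp t ht

lemma IsAssignment.adjustedSet_nonempty {I : FairInstance d m} {T : Finset (Pt d)}
    {φ : Pt d → Pt d → ℝ} (hφ : I.IsAssignment T φ) (hP : I.points.Nonempty) :
    (I.adjustedSet T φ).Nonempty := by
  classical
  obtain ⟨p, hp⟩ := hP
  have hpos : ∃ t ∈ T, 0 < φ p t := by
    by_contra! hcon
    have := hφ.2 p hp
    have h0 := Finset.sum_nonpos hcon
    linarith
  obtain ⟨t, ht, htp⟩ := hpos
  refine ⟨I.adjust φ t, Finset.mem_image_of_mem _ (Finset.mem_filter.2 ⟨ht, ?_⟩)⟩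
  exact htp.trans_le (Finset.single_le_sum (f := fun p => φ p t)
    (fun p hp => hφ.1 p hp t ht) hp)

lemma adjustedWeight_pos (I : FairInstance d m) {T : Finset (Pt d)} {φ : Pt d → Pt d → ℝ}
    {q : Pt d} (hq : q ∈ I.adjustedSet T φ) : 0 < I.adjustedWeight T φ q := by
  classical
  obtain ⟨t, ht, rfl⟩ := Finset.mem_image.1 hq
  obtain ⟨htT, hpos⟩ := Finset.mem_filter.1 ht
  exact Finset.sum_pos (fun t ht => (Finset.mem_filter.1 ht).2.1)
    ⟨t, Finset.mem_filter.2 ⟨htT, hpos, rfl⟩⟩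

lemma IsAssignment.kMeansCost_adjusted {I : FairInstance d m} {T : Finset (Pt d)}
    {φ : Pt d → Pt d → ℝ} (hφ : I.IsAssignment T φ) (X : Finset (Pt d)) :
    kMeansCost (I.adjustedSet T φ) (I.adjustedWeight T φ) X =
      ∑ t ∈ T, weightOn I.points φ t * Metric.infDist (I.adjust φ t) (X : Set (Pt d)) ^ 2 := by
  classical
  have hpos : ∑ t ∈ T, weightOn I.points φ t * Metric.infDist (I.adjust φ t) (X : Set (Pt d)) ^ 2
      = ∑ t ∈ T.filter (fun t => 0 < weightOn I.points φ t),
        weightOn I.points φ t * Metric.infDist (I.adjust φ t) (X : Set (Pt d)) ^ 2 := by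
    rw [Finset.sum_filter_of_ne]
    intro t ht hne
    exact lt_of_le_of_ne (hφ.weightOn_nonneg ht) fun h => hne (by rw [← h, zero_mul])
  rw [hpos, ← Finset.sum_fiberwise_of_maps_to (g := I.adjust φ) (t := I.adjustedSet T φ)
    fun t ht => by
      rw [adjustedSet]
      convert Finset.mem_image_of_mem (I.adjust φ) ht]
  refine Finset.sum_congr rfl fun q _ => ?_
  rw [adjustedWeight, Finset.sum_mul, Finset.filter_filter]
  refine Finset.sum_congr (by congr) fun t ht => ?_
  rw [(Finset.mem_filter.1 ht).2.2]

/-- Each point `p` that sends weight to `t` is served by `S` in `φ`, so that the distance from the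
centroid of `t` to `S` is at most the distance from this centroid to `p` plus that from `p` to its
center; these bounds are averaged over the points `p` and their centers. -/
lemma IsAssignment.kMeansCost_adjusted_le {I : FairInstance d m} {S T : Finset (Pt d)}
    {φT φ : Pt d → Pt d → ℝ} (hφT : I.IsAssignment T φT) (hφ : I.IsAssignment S φ) :
    kMeansCost (I.adjustedSet T φT) (I.adjustedWeight T φT) S ≤
      2 * ∑ t ∈ T, ∑ p ∈ I.points, ‖p - I.adjust φT t‖ ^ 2 * φT p t + 2 * I.cost S φ := by
  rw [hφT.kMeansCost_adjusted]
  have hpt : ∀ t ∈ T, ∀ p ∈ I.points,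
      φT p t * Metric.infDist (I.adjust φT t) (S : Set (Pt d)) ^ 2 ≤
        2 * (‖p - I.adjust φT t‖ ^ 2 * φT p t) +
          2 * (φT p t * ∑ s ∈ S, ‖p - s‖ ^ 2 * φ p s) := by
    intro t ht p hp
    have hs : ∀ s ∈ S, Metric.infDist (I.adjust φT t) (S : Set (Pt d)) ^ 2 * φ p s ≤
        2 * ‖p - I.adjust φT t‖ ^ 2 * φ p s + 2 * (‖p - s‖ ^ 2 * φ p s) := by
      intro s hs
      have h1 : Metric.infDist (I.adjust φT t) (S : Set (Pt d)) ≤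
          ‖p - I.adjust φT t‖ + ‖p - s‖ := by
        refine (Metric.infDist_le_dist_of_mem (Finset.mem_coe.2 hs)).trans ?_
        rw [← dist_eq_norm, ← dist_eq_norm]
        exact dist_triangle_left _ _ _
      have h2 := pow_le_pow_left₀ Metric.infDist_nonneg h1 2
      have h3 : Metric.infDist (I.adjust φT t) (S : Set (Pt d)) ^ 2 ≤
          2 * ‖p - I.adjust φT t‖ ^ 2 + 2 * ‖p - s‖ ^ 2 := by
        nlinarith [sq_nonneg (‖p - I.adjust φT t‖ - ‖p - s‖)]
      calc _ ≤ (2 * ‖p - I.adjust φT t‖ ^ 2 + 2 * ‖p - s‖ ^ 2) * φ p s :=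
            mul_le_mul_of_nonneg_right h3 (hφ.1 p hp s hs)
        _ = _ := by ring
    have hsum := Finset.sum_le_sum hs
    rw [Finset.sum_add_distrib, ← Finset.mul_sum, ← Finset.mul_sum, ← Finset.mul_sum,
      hφ.2 p hp, mul_one, mul_one] at hsum
    have := mul_le_mul_of_nonneg_left hsum (hφT.1 p hp t ht)
    linarith
  calc ∑ t ∈ T, weightOn I.points φT t * Metric.infDist (I.adjust φT t) (S : Set (Pt d)) ^ 2
      = ∑ t ∈ T, ∑ p ∈ I.points,
          φT p t * Metric.infDist (I.adjust φT t) (S : Set (Pt d)) ^ 2 := by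
        refine Finset.sum_congr rfl fun t _ => ?_
        rw [weightOn, Finset.sum_mul]
    _ ≤ ∑ t ∈ T, ∑ p ∈ I.points, (2 * (‖p - I.adjust φT t‖ ^ 2 * φT p t) +
          2 * (φT p t * ∑ s ∈ S, ‖p - s‖ ^ 2 * φ p s)) :=
        Finset.sum_le_sum fun t ht => Finset.sum_le_sum fun p hp => hpt t ht p hp
    _ = 2 * ∑ t ∈ T, ∑ p ∈ I.points, ‖p - I.adjust φT t‖ ^ 2 * φT p t +
          2 * ∑ p ∈ I.points, ∑ t ∈ T, φT p t * ∑ s ∈ S, ‖p - s‖ ^ 2 * φ p s := by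
        rw [Finset.sum_comm (s := I.points) (t := T)]
        simp only [Finset.sum_add_distrib, Finset.mul_sum]
    _ = _ := by
        congr 2
        refine Finset.sum_congr rfl fun p hp => ?_
        rw [← Finset.sum_mul, hφT.2 p hp, one_mul]

/-- Whatever the relaxed assignment sends to `t` can be passed on to the center of `S` nearest to
the centroid of `t`. -/
lemma IsOptimalAssignment.cost_le_merge {I : FairInstance d m} {S T : Finset (Pt d)}
    {φT φ : Pt d → Pt d → ℝ} (hφT : I.IsAssignment T φT) (hfair : I.IsFair T φT)
    (hS : S.Nonempty) (hφ : I.IsOptimalAssignment S φ) :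
    I.cost S φ ≤ ∑ t ∈ T, ∑ p ∈ I.points, ‖p - I.adjust φT t‖ ^ 2 * φT p t +
      kMeansCost (I.adjustedSet T φT) (I.adjustedWeight T φT) S := by
  have hnear : ∀ t, ∃ s ∈ S,
      Metric.infDist (I.adjust φT t) (S : Set (Pt d)) = dist (I.adjust φT t) s := by
    intro t
    obtain ⟨s, hs, h⟩ := S.finite_toSet.isCompact.exists_infDist_eq_dist
      (Finset.coe_nonempty.2 hS) (I.adjust φT t)
    exact ⟨s, Finset.mem_coe.1 hs, h⟩
  choose τ hτS hτ using hnear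
  calc I.cost S φ ≤ I.cost S (reassign T φT τ) :=
        hφ.2 _ (hφT.reassign fun t _ => hτS t) (hfair.reassign _ _)
    _ = ∑ t ∈ T, ∑ p ∈ I.points, ‖p - τ t‖ ^ 2 * φT p t := by
        rw [I.cost_reassign φT fun t _ => hτS t, Finset.sum_comm]
    _ = _ := by
        rw [hφT.kMeansCost_adjusted, ← Finset.sum_add_distrib]
        refine Finset.sum_congr rfl fun t ht => ?_
        rw [I.sum_sq_dist_eq_adjust (fun p hp => hφT.1 p hp t ht) (τ t), hτ t, dist_eq_norm]

lemma IsAssignment.sum_adjust_le_cost {I : FairInstance d m} {T : Finset (Pt d)}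
    {φ : Pt d → Pt d → ℝ} (hφ : I.IsAssignment T φ) :
    ∑ t ∈ T, ∑ p ∈ I.points, ‖p - I.adjust φ t‖ ^ 2 * φ p t ≤ I.cost T φ := by
  rw [cost_eq_sum_centers]
  refine Finset.sum_le_sum fun t ht => ?_
  rw [I.sum_sq_dist_eq_adjust (fun p hp => hφ.1 p hp t ht) t]
  exact le_add_of_nonneg_right (mul_nonneg (hφ.weightOn_nonneg ht) (sq_nonneg _))

lemma IsAssignment.cost_nonneg {I : FairInstance d m} {S : Finset (Pt d)}
    {φ : Pt d → Pt d → ℝ} (hφ : I.IsAssignment S φ) : 0 ≤ I.cost S φ :=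
  Finset.sum_nonneg fun p hp => Finset.sum_nonneg fun s hs =>
    mul_nonneg (sq_nonneg _) (hφ.1 p hp s hs)

/-! ### Rounding the output -/

/-- Bounded changes of the group and cluster weights turn fairness into bounded violation. -/
lemma IsFair.hasViolation_of_close {I : FairInstance d m} {S : Finset (Pt d)}
    {φ ψ : Pt d → Pt d → ℝ} (hφ : I.IsFair S φ) {a b : ℝ} (hb : 0 ≤ b)
    (hG : ∀ s ∈ S, ∀ i, |weightOn (I.groups i) ψ s - weightOn (I.groups i) φ s| ≤ a)
    (hT : ∀ s ∈ S, |weightOn I.points ψ s - weightOn I.points φ s| ≤ b) :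
    I.HasViolation (a + b) S ψ := by
  intro s hs i
  obtain ⟨h1, h2⟩ := hφ s hs i
  obtain ⟨h3, h4⟩ := abs_le.1 (hG s hs i)
  obtain ⟨h5, h6⟩ := abs_le.1 (hT s hs)
  obtain ⟨hα0, hα1⟩ := I.α_mem i
  obtain ⟨hβ0, hβ1⟩ := I.β_mem i
  constructor <;> nlinarith

lemma IsAssignment.isPairAssignment {I : FairInstance d m} {S : Finset (Pt d)}
    {φ : Pt d → Pt d → ℝ} (hφ : I.IsAssignment S φ) :
    IsPairAssignment I.points S fun e => φ e.1 e.2 := by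
  refine ⟨fun e he => ?_, fun p hp => ?_⟩
  · obtain ⟨h1, h2⟩ := Finset.mem_product.1 he
    exact ⟨hφ.1 _ h1 _ h2, hφ.le_one h1 h2⟩
  · rw [Finset.sum_product, Finset.sum_singleton]
    exact hφ.2 p hp

lemma isIntegralAssignment_of_pair {I : FairInstance d m} {S : Finset (Pt d)}
    {ψ : Pt d × Pt d → ℝ} (hψ : IsPairAssignment I.points S ψ)
    (h01 : ∀ e ∈ I.points ×ˢ S, ψ e = 0 ∨ ψ e = 1) :
    I.IsIntegralAssignment S fun p s => ψ (p, s) := by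
  refine ⟨⟨fun p hp s hs => (hψ.mem_unit _ (Finset.mk_mem_product hp hs)).1, fun p hp => ?_⟩,
    fun p hp s hs => h01 _ (Finset.mk_mem_product hp hs)⟩
  have := hψ.row_sum p hp
  rwa [Finset.sum_product, Finset.sum_singleton] at this

lemma sum_product_singleton_eq_weightOn (A : Finset (Pt d)) (ψ : Pt d × Pt d → ℝ) (s : Pt d) :
    ∑ e ∈ A ×ˢ {s}, ψ e = weightOn A (fun p s => ψ (p, s)) s := by
  rw [Finset.sum_product]
  simp [weightOn]

lemma cost_eq_sum_product (I : FairInstance d m) (S : Finset (Pt d)) (ψ : Pt d × Pt d → ℝ) :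
    I.cost S (fun p s => ψ (p, s)) = ∑ e ∈ I.points ×ˢ S, ‖e.1 - e.2‖ ^ 2 * ψ e := by
  rw [Finset.sum_product]
  rfl

theorem exists_integral_of_fair (I : FairInstance d m) {S : Finset (Pt d)} {φ : Pt d → Pt d → ℝ}
    (hφ : I.IsAssignment S φ) (hfair : I.IsFair S φ) :
    ∃ ψ, I.IsIntegralAssignment S ψ ∧ I.HasViolation (3 * I.maxGroups + 4) S ψ ∧
      I.cost S ψ ≤ I.cost S φ := by
  classical
  obtain ⟨ψ, h1, h2, h3, h4, h5⟩ := exists_integral_assignment_of_overlap I.groups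
    I.group_subset I.maxGroups (fun p hp J hJ => by
      have h1 : J ⊆ Finset.univ.filter fun i => p ∈ I.groups i := fun i hi =>
        Finset.mem_filter.2 ⟨Finset.mem_univ _, hJ i hi⟩
      refine (Finset.card_le_card h1).trans ?_
      rw [maxGroups]
      convert Finset.le_sup (f := fun p => (Finset.univ.filter fun i => p ∈ I.groups i).card) hp)
    hφ.isPairAssignment fun e => ‖e.1 - e.2‖ ^ 2
  simp only [sum_product_singleton_eq_weightOn] at h3 h4
  rw [← cost_eq_sum_product, ← cost_eq_sum_product] at h5
  refine ⟨_, isIntegralAssignment_of_pair h1 h2, ?_, h5⟩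
  have := hfair.hasViolation_of_close (by positivity) h3 h4
  convert this using 1
  ring

theorem exists_integral_of_fair_of_disjoint (I : FairInstance d m) {S : Finset (Pt d)}
    {φ : Pt d → Pt d → ℝ} (hP : I.points.Nonempty) (hφ : I.IsAssignment S φ)
    (hfair : I.IsFair S φ) (hdisj : ∀ i j, i ≠ j → Disjoint (I.groups i) (I.groups j)) :
    ∃ ψ, I.IsIntegralAssignment S ψ ∧ I.HasViolation 2 S ψ ∧ I.cost S ψ ≤ I.cost S φ := by
  classical
  obtain ⟨p₀, hp₀⟩ := hP
  obtain ⟨i₀, -⟩ := (I.mem_points_iff p₀).1 hp₀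
  let g : Pt d → Fin m := fun p => if h : ∃ i, p ∈ I.groups i then h.choose else i₀
  have hg : ∀ p ∈ I.points, ∀ i, p ∈ I.groups i ↔ g p = i := by
    intro p hp i
    have hex := (I.mem_points_iff p).1 hp
    have hgp : p ∈ I.groups (g p) := by
      simp only [g, dif_pos hex]
      exact hex.choose_spec
    refine ⟨fun hi => ?_, fun h => h ▸ hgp⟩
    by_contra hne
    exact Finset.disjoint_left.1 (hdisj _ _ hne) hgp hi
  obtain ⟨ψ, h1, h2, h3, h4, h5⟩ := exists_integral_assignment_of_disjoint I.groups
    I.group_subset g hg hφ.isPairAssignment fun e => ‖e.1 - e.2‖ ^ 2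
  simp only [sum_product_singleton_eq_weightOn] at h3 h4
  rw [← cost_eq_sum_product, ← cost_eq_sum_product] at h5
  refine ⟨_, isIntegralAssignment_of_pair h1 h2, ?_, h5⟩
  have := hfair.hasViolation_of_close zero_le_one h3 h4
  convert this using 1
  norm_num

end FairInstance

/-! ### The algorithm -/

namespace FairInstance

variable {d m : ℕ}

lemma IsIntegralSolution.one_le_k {I : FairInstance d m} {S : Finset (Pt d)}
    {φ : Pt d → Pt d → ℝ} (h : I.IsIntegralSolution S φ) (hP : I.points.Nonempty) : 1 ≤ I.k :=
  (Finset.card_pos.2 (h.2.1.1.nonempty hP)).trans_le h.1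

lemma nonempty_of_isApproxCentroidSet {P T : Finset (Pt d)} {ε : ℝ} (hP : P.Nonempty)
    (hT : IsApproxCentroidSet ε P T) : T.Nonempty := by
  obtain ⟨v, hv, -⟩ := hT P subset_rfl hP
  exact ⟨v, hv⟩

lemma exists_isRelaxAndMergeOutput {I : FairInstance d m} {ρ ε : ℝ} {A : KMeansAlgorithm d}
    (hP : I.points.Nonempty) (hI : I.Feasible) (hA : IsApproxKMeans ρ A) {T : Finset (Pt d)}
    (hT : IsApproxCentroidSet ε I.points T) : ∃ S φ, I.IsRelaxAndMergeOutput A ε T S φ := by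
  obtain ⟨φT, hφT⟩ := hI.exists_isOptimalAssignment (nonempty_of_isApproxCentroidSet hP hT)
  obtain ⟨S₀, φ₀, h₀⟩ := hI
  obtain ⟨hS, -, -⟩ := hA (I.adjustedSet T φT) (I.adjustedWeight T φT) I.k
    (hφT.1.1.adjustedSet_nonempty hP) (fun q hq => I.adjustedWeight_pos hq) (h₀.one_le_k hP)
  obtain ⟨φ, hφ⟩ := Feasible.exists_isOptimalAssignment ⟨S₀, φ₀, h₀⟩ hS
  exact ⟨_, φ, hT, φT, hφT, rfl, hφ⟩

lemma IsRelaxAndMergeOutput.isFractionalSolution {I : FairInstance d m} {ρ ε : ℝ}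
    {A : KMeansAlgorithm d} (hP : I.points.Nonempty) (hI : I.Feasible) (hA : IsApproxKMeans ρ A)
    {T S : Finset (Pt d)} {φ : Pt d → Pt d → ℝ} (h : I.IsRelaxAndMergeOutput A ε T S φ) :
    I.IsFractionalSolution S φ := by
  obtain ⟨-, φT, hφT, rfl, hφ⟩ := h
  obtain ⟨S₀, φ₀, h₀⟩ := hI
  exact ⟨(hA _ _ I.k (hφT.1.1.adjustedSet_nonempty hP) (fun q hq => I.adjustedWeight_pos hq)
    (h₀.one_le_k hP)).2.1, hφ.1⟩

/-- With `c` the cost of an integral solution and `c₁` the cost of the relaxed assignment to the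
moved centers, `c₁ ≤ (1 + ε²/9) c`, the centers of the integral solution have vanilla cost at most
`2 c₁ + 2 c` in the merge step, and the output costs at most `c₁ + ρ (2 c₁ + 2 c)`. -/
lemma IsRelaxAndMergeOutput.cost_le {I : FairInstance d m} {ρ ε : ℝ} {A : KMeansAlgorithm d}
    (hP : I.points.Nonempty) (hρ : 1 ≤ ρ) (hA : IsApproxKMeans ρ A) (hε : 0 < ε) (hε1 : ε ≤ 1)
    {T S : Finset (Pt d)} {φ : Pt d → Pt d → ℝ} (h : I.IsRelaxAndMergeOutput A ε T S φ)
    {S₀ : Finset (Pt d)} {φ₀ : Pt d → Pt d → ℝ} (h₀ : I.IsIntegralSolution S₀ φ₀) :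
    I.cost S φ ≤ (1 + 4 * ρ + 1 * ρ * ε) * I.cost S₀ φ₀ := by
  obtain ⟨hT, φT, hφT, rfl, hφ⟩ := h
  obtain ⟨hS, -, hmin⟩ := hA (I.adjustedSet T φT) (I.adjustedWeight T φT) I.k
    (hφT.1.1.adjustedSet_nonempty hP) (fun q hq => I.adjustedWeight_pos hq) (h₀.one_le_k hP)
  have hrelax := hφT.cost_le_of_approxCentroidSet hT (nonempty_of_isApproxCentroidSet hP hT) h₀
  have hmove := hφT.1.1.sum_adjust_le_cost
  have hmerge := hφ.cost_le_merge hφT.1.1 hφT.1.2 hS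
  have hkm := hmin S₀ (h₀.2.1.1.nonempty hP) h₀.1
  have hopt := hφT.1.1.kMeansCost_adjusted_le h₀.2.1.1
  have hc0 : 0 ≤ I.cost S₀ φ₀ := h₀.2.1.1.cost_nonneg
  generalize I.cost S₀ φ₀ = c at *
  generalize ∑ t ∈ T, ∑ p ∈ I.points, ‖p - I.adjust φT t‖ ^ 2 * φT p t = c₁ at *
  have hc₁ : c₁ ≤ (1 + ε ^ 2 / 9) * c := hmove.trans hrelax
  have hε2 : ε ^ 2 ≤ ε := by nlinarith
  calc I.cost _ φ ≤ c₁ + ρ * (2 * c₁ + 2 * c) := by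
        refine hmerge.trans (add_le_add_right (hkm.trans ?_) _)
        exact mul_le_mul_of_nonneg_left hopt (by linarith)
    _ = (1 + 2 * ρ) * c₁ + 2 * ρ * c := by ring
    _ ≤ (1 + 2 * ρ) * ((1 + ε ^ 2 / 9) * c) + 2 * ρ * c := by gcongr
    _ = (1 + 4 * ρ + (1 + 2 * ρ) * (ε ^ 2 / 9)) * c := by ring
    _ ≤ (1 + 4 * ρ + 1 * ρ * ε) * c := by
        refine mul_le_mul_of_nonneg_right ?_ hc0
        have : (1 + 2 * ρ) * (ε ^ 2 / 9) ≤ (9 * ρ) * (ε / 9) := by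
          gcongr
          linarith
        linarith

lemma Feasible.le_mul_opt {I : FairInstance d m} (hI : I.Feasible) {r x : ℝ} (hr : 0 < r)
    (h : ∀ S φ, I.IsIntegralSolution S φ → x ≤ r * I.cost S φ) : x ≤ r * I.opt := by
  rw [← div_le_iff₀' hr]
  obtain ⟨S, φ, hS⟩ := hI
  refine le_csInf ⟨_, S, φ, hS, rfl⟩ ?_
  rintro c ⟨S, φ, hS, rfl⟩
  rw [div_le_iff₀' hr]
  exact h S φ hS

end FairInstance

/-- The Relax-and-Merge algorithm is a `(1 + 4ρ + O(ε))`-approximation for fractional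
`(α, β)`-fair `k`-means, and its output can be rounded to an integral assignment with constant
violation and no increase in cost. -/
theorem theorem1 :
    ∃ C : ℝ, 0 < C ∧ ∀ d : ℕ, ∃ K : ℕ,
      ∀ (m : ℕ) (I : FairInstance d m) (ρ ε : ℝ) (A : KMeansAlgorithm d),
        I.points.Nonempty → I.Feasible → 1 ≤ ρ → IsApproxKMeans ρ A → 0 < ε → ε ≤ 1 →
        -- the first step is possible with polynomially many relaxed centers
        (∃ T, IsApproxCentroidSet ε I.points T ∧
          (T.card : ℝ) ≤ (K * (I.points.card : ℝ) / ε) ^ K) ∧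
        -- the algorithm can be carried out with any approximate centroid set
        (∀ T, IsApproxCentroidSet ε I.points T →
          ∃ S φ, I.IsRelaxAndMergeOutput A ε T S φ) ∧
        -- and whatever it returns is as claimed
        (∀ T S φ, I.IsRelaxAndMergeOutput A ε T S φ →
          I.IsFractionalSolution S φ ∧
          I.cost S φ ≤ (1 + 4 * ρ + C * ρ * ε) * I.opt ∧
          (∃ ψ, I.IsIntegralAssignment S ψ ∧
            I.HasViolation (3 * I.maxGroups + 4) S ψ ∧
            I.cost S ψ ≤ I.cost S φ) ∧
          ((∀ i j, i ≠ j → Disjoint (I.groups i) (I.groups j)) →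
            ∃ ψ, I.IsIntegralAssignment S ψ ∧
              I.HasViolation 2 S ψ ∧
              I.cost S ψ ≤ I.cost S φ)) := by
  refine ⟨1, one_pos, fun d => ⟨18 * d + 21, fun m I ρ ε A hP hI hρ hA hε hε1 =>
    ⟨exists_small_approxCentroidSet I.points hP hε hε1,
      fun T hT => FairInstance.exists_isRelaxAndMergeOutput hP hI hA hT,
      fun T S φ h => ?_⟩⟩⟩
  have hsol := h.isFractionalSolution hP hI hA
  exact ⟨hsol, hI.le_mul_opt (by positivity) fun S₀ φ₀ h₀ => h.cost_le hP hρ hA hε hε1 h₀,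
    I.exists_integral_of_fair hsol.2.1 hsol.2.2,
    I.exists_integral_of_fair_of_disjoint hP hsol.2.1 hsol.2.2⟩
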